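/- Let $G$ be a finite group. For a domain $R$, let $\Psi_{R[G]}$ be the homomorphism from the Burnside group of $G$ (the free abelian group on isomorphism classes of transitive $G$-sets, in which a subgroup $U\leq G$ represents the class of $G/U$) to the representation group of $G$ over $R$ (the abelian group generated by the isomorphism classes $[M]$ of finitely generated $R$-free $R[G]$-modules, with relations $[M\oplus N]=[M]+[N]$) that sends a $G$-set $S$ to the class of the permutation module $R[S]$. An $R[G]$-relation is an element of $\ker\Psi_{R[G]}$, and a $G$-relation is a $\mathbb{Q}[G]$-relation. For an abelian group $A$ and a prime $p$ write $A[p^\infty]$ for its $p$-primary torsion subgroup, $A_{\mathrm{tors}}$ for its torsion subgroup, and let $\mathbb{Z}_{(p)}=\{\frac ab : p\nmid b\}\subset\mathbb{Q}$. Let $X\to Y$ be a finite $G$-covering of topological spaces, i.e. a quotient map whose fibres are the orbits of an action of $G$ on $X$ by homeomorphisms such that every point of $X$ has a neighbourhood $V$ with $gV\cap V=\emptyset$ for all $1\neq g\in G$. (For example, $X\to Y$ may be a $G$-covering of closed Riemannian manifolds.) Let $p$ be a prime number and let $i\geq 0$ be an integer. Homology is singular homology. (1) Let $U_j$, $U'_k$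 be finitely many subgroups of $G$ and let $n_j$, $n'_k$ be positive integers such that $\Theta=\sum_j n_jU_j-\sum_k n'_kU'_k$ is a $\mathbb{Z}_{(p)}[G]$-relation. Then $$\bigoplus_j H_i(X/U_j,\mathbb{Z})[p^\infty]^{n_j}\cong\bigoplus_k H_i(X/U'_k,\mathbb{Z})[p^\infty]^{n'_k}.$$ In particular, $$\mathrm{ord}_p\Bigl(\prod_j \bigl(\#H_i(X/U_j,\mathbb{Z})_{\mathrm{tors}}\bigr)^{n_j}\Big/\prod_k \bigl(\#H_i(X/U'_k,\mathbb{Z})_{\mathrm{tors}}\bigr)^{n'_k}\Bigr)=0,$$ whenever all of these torsion subgroups are finite, as is the case for closed manifolds. (If one of them is infinite, the formula is read with the conventions that the order of an infinite group is $0$, that $a/0=0$, and that $\mathrm{ord}_p(0)=0$.) (2) Suppose that $p\nmid\#G$, and let $U_j$, $U'_k$ be finitely many subgroups of $G$ and $n_j$, $n'_k$ positive integers such that $\sum_j n_jU_j-\sum_k n'_kU'_k$ is a $G$-relation. Then $$\bigoplus_j H_i(X/U_j,\mathbb{Z})[p^\infty]^{n_j}\cong\bigoplus_k H_i(X/U'_k,\mathbb{Z})[p^\infty]^{n'_k}.$$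 (3) Suppose that $p\nmid\#G$, and let $U_1,U_2\leq G$ be such that $U_1-U_2$ is a $G$-relation. Then $$H_i(X/U_1,\mathbb{Z})[p^\infty]\cong H_i(X/U_2,\mathbb{Z})[p^\infty].$$ -/

import Mathlib

open scoped DirectSum MonoidAlgebra

universe u v w

noncomputable section

/-! ## The Burnside group -/

/-- A transitive (in particular nonempty) `G`-set. -/
structure TransitiveGSet (G : Type v) [Group G] where
  carrier : Type v
  [action : MulAction G carrier]
  [transitive : MulAction.IsPretransitive G carrier]
  [nonempty : Nonempty carrier]

attribute [instance] TransitiveGSet.action TransitiveGSet.transitive TransitiveGSet.nonempty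

/-- Isomorphism of transitive `G`-sets: a `G`-equivariant bijection. -/
instance TransitiveGSet.setoid (G : Type v) [Group G] : Setoid (TransitiveGSet G) where
  r S T := ∃ e : S.carrier ≃ T.carrier, ∀ (g : G) (x : S.carrier), e (g • x) = g • e x
  iseqv :=
    { refl := fun _ => ⟨Equiv.refl _, fun _ _ => rfl⟩
      symm := by
        rintro S T ⟨e, he⟩
        exact ⟨e.symm, fun g x => by rw [Equiv.symm_apply_eq, he, Equiv.apply_symm_apply]⟩
      trans := by
        rintro S T V ⟨e, he⟩ ⟨e', he'⟩
        exact ⟨e.trans e', fun g x => by simp [he, he']⟩ }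

/-- The Burnside group of `G`: the free abelian group on isomorphism classes of transitive
`G`-sets. -/
abbrev BurnsideGroup (G : Type v) [Group G] : Type (v + 1) :=
  FreeAbelianGroup (Quotient (TransitiveGSet.setoid G))

/-- The element of the Burnside group represented by the subgroup `U`, i.e. the class of `G ⧸ U`
with the left multiplication action. -/
def burnsideOf {G : Type v} [Group G] (U : Subgroup G) : BurnsideGroup G :=
  FreeAbelianGroup.of (Quotient.mk _ { carrier := G ⧸ U })

/-! ## The representation group -/

/-- An `R[G]`-lattice: a finitely generated `R[G]`-module that is free over `R`, given as an
`R`-linear representation of `G` on a finitely generated free `R`-module. -/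
structure RepLattice (R : Type u) [CommRing R] (G : Type v) [Group G] where
  carrier : Type (max u v)
  [addCommGroup : AddCommGroup carrier]
  [module : Module R carrier]
  [free : Module.Free R carrier]
  [finite : Module.Finite R carrier]
  rep : Representation R G carrier

attribute [instance] RepLattice.addCommGroup RepLattice.module RepLattice.free RepLattice.finite

namespace RepLattice

variable (R : Type u) [CommRing R] (G : Type v) [Group G]

/-- Isomorphism of `R[G]`-lattices. -/
instance setoid : Setoid (RepLattice R G) where
  r M N := Nonempty (M.rep.Equiv N.rep)
  iseqv :=
    { refl := fun _ => ⟨.refl _⟩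
      symm := fun ⟨e⟩ => ⟨e.symm⟩
      trans := fun ⟨e⟩ ⟨e'⟩ => ⟨e.trans e'⟩ }

variable {R G}

/-- The direct sum of two `R[G]`-lattices. -/
def prod (M N : RepLattice R G) : RepLattice R G where
  carrier := M.carrier × N.carrier
  rep := M.rep.prod N.rep

variable (R G) in
/-- The zero lattice. -/
def zero : RepLattice R G where
  carrier := PUnit.{max u v + 1}
  rep := Representation.trivial R G PUnit.{max u v + 1}

/-- Lattices whose underlying modules are isomorphic by a map commuting with `G` are equivalent. -/
theorem equiv_of_linearEquiv {M N : RepLattice R G} (e : M.carrier ≃ₗ[R] N.carrier)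
    (he : ∀ (g : G) (x : M.carrier), e (M.rep g x) = N.rep g (e x)) : M ≈ N :=
  ⟨.mk e fun g => LinearMap.ext fun x => he g x⟩

variable (R G) in
/-- The set of isomorphism classes of `R[G]`-lattices. -/
def IsoClass : Type (max u v + 1) := Quotient (RepLattice.setoid R G)

/-- The isomorphism class of a lattice. -/
def isoClass (M : RepLattice R G) : IsoClass R G := Quotient.mk _ M

instance : Zero (IsoClass R G) := ⟨isoClass (zero R G)⟩

instance : Add (IsoClass R G) := ⟨Quotient.map₂ prod (by
  rintro M M' ⟨e⟩ N N' ⟨e'⟩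
  refine equiv_of_linearEquiv (M := M.prod N) (N := M'.prod N')
    (e.toLinearEquiv.prodCongr e'.toLinearEquiv) fun g x => ?_
  exact Prod.ext (e.toIntertwiningMap.isIntertwining _ _ g x.1)
    (e'.toIntertwiningMap.isIntertwining _ _ g x.2))⟩

/-- The commutative monoid of isomorphism classes of `R[G]`-lattices under direct sum. -/
instance : AddCommMonoid (IsoClass R G) where
  nsmul := nsmulRec
  add_assoc := by
    rintro ⟨M⟩ ⟨N⟩ ⟨L⟩
    exact Quotient.sound (equiv_of_linearEquiv (M := (M.prod N).prod L) (N := M.prod (N.prod L))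
      (LinearEquiv.prodAssoc R M.carrier N.carrier L.carrier) fun g x => rfl)
  zero_add := by
    rintro ⟨M⟩
    exact Quotient.sound (equiv_of_linearEquiv (M := (zero R G).prod M) (N := M)
      (LinearEquiv.uniqueProd (R := R) (M := M.carrier) (M₂ := PUnit.{max u v + 1})) fun g x => rfl)
  add_zero := by
    rintro ⟨M⟩
    exact Quotient.sound (equiv_of_linearEquiv (M := M.prod (zero R G)) (N := M)
      (LinearEquiv.prodUnique (R := R) (M := M.carrier) (M₂ := PUnit.{max u v + 1})) fun g x => rfl)
  add_comm := by
    rintro ⟨M⟩ ⟨N⟩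
    exact Quotient.sound (equiv_of_linearEquiv (M := M.prod N) (N := N.prod M)
      (LinearEquiv.prodComm R M.carrier N.carrier) fun g x => rfl)

theorem isoClass_add (M N : RepLattice R G) :
    M.isoClass + N.isoClass = (M.prod N).isoClass := rfl

end RepLattice

/-- The representation group of `G` over `R`: the abelian group generated by the isomorphism
classes `[M]` of `R[G]`-lattices with the relations `[M ⊕ N] = [M] + [N]`. -/
abbrev RepresentationGroup (R : Type u) [CommRing R] (G : Type v) [Group G] :
    Type (max u v + 1) :=
  Algebra.GrothendieckAddGroup (RepLattice.IsoClass R G)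

section Relations

variable (R : Type u) [CommRing R] {G : Type v} [Group G] [Finite G]

theorem TransitiveGSet.finite_carrier (S : TransitiveGSet G) : Finite S.carrier := by
  obtain ⟨x⟩ := S.nonempty
  exact Finite.of_surjective (fun g : G => g • x) (MulAction.surjective_smul G x)

/-- The permutation lattice `R[S]` attached to a transitive `G`-set `S`. -/
def permLattice (S : TransitiveGSet G) : RepLattice R G :=
  haveI := S.finite_carrier
  { carrier := R[S.carrier]
    free := Module.Free.of_equiv (MonoidAlgebra.coeffLinearEquiv (S := R) R (M := S.carrier)).symm
    finite := Module.Finite.equiv (MonoidAlgebra.coeffLinearEquiv (S := R) R (M := S.carrier)).symm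
    rep := Representation.ofMulAction R G S.carrier }

/-- The natural homomorphism from the Burnside group of `G` to the representation group of `G`
over `R`, sending a `G`-set `S` to the permutation module `R[S]`. -/
def burnsideToRep : BurnsideGroup G →+ RepresentationGroup R G :=
  FreeAbelianGroup.lift <| Quotient.lift
    (fun S => Algebra.GrothendieckAddGroup.of (permLattice R S).isoClass) (by
      rintro S T ⟨e, he⟩
      refine congrArg _ (Quotient.sound ?_)
      refine RepLattice.equiv_of_linearEquiv (M := permLattice R S) (N := permLattice R T)
        (MonoidAlgebra.mapDomainLinearEquiv R R e) fun g x => ?_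
      have key : (MonoidAlgebra.mapDomainLinearEquiv R R e).toLinearMap ∘ₗ
          Representation.ofMulAction R G S.carrier g =
          Representation.ofMulAction R G T.carrier g ∘ₗ
            (MonoidAlgebra.mapDomainLinearEquiv R R e).toLinearMap := by
        ext; simp [he]
      exact LinearMap.congr_fun key x)

/-- An `R[G]`-relation is an element of the kernel of the natural homomorphism from the Burnside
group to the representation group over `R`. -/
def IsRelation (Θ : BurnsideGroup G) : Prop :=
  Θ ∈ (burnsideToRep R (G := G)).ker

end Relations

/-- `ℤ_(p)`, the subring of `ℚ` of fractions with denominator prime to `p`. -/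
def zLocal (p : ℕ) [hp : Fact p.Prime] : Subring ℚ where
  carrier := {x | ¬ p ∣ x.den}
  mul_mem' {a b} ha hb h :=
    (hp.out.dvd_mul.mp (h.trans (Rat.mul_den_dvd a b))).elim ha hb
  one_mem' := by simpa using hp.out.one_lt.ne'
  add_mem' {a b} ha hb h :=
    (hp.out.dvd_mul.mp (h.trans (Rat.add_den_dvd a b))).elim ha hb
  zero_mem' := by simpa using hp.out.one_lt.ne'
  neg_mem' {a} ha := by simpa using ha

/-! ## Homology of the quotients -/

/-- Integral singular homology `H_i(T, ℤ)` of a topological space. -/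
abbrev integralHomology (i : ℕ) (T : Type u) [TopologicalSpace T] : ModuleCat.{u} ℤ :=
  ((AlgebraicTopology.singularHomologyFunctor (ModuleCat.{u} ℤ) i).obj
    (ModuleCat.of ℤ (ULift.{u} ℤ))).obj (TopCat.of T)

/-- `H_i(X/U, ℤ)`, where `X/U` is the orbit space of the subgroup `U` with the quotient
topology. -/
abbrev quotientHomology {G : Type v} [Group G] (X : Type u) [TopologicalSpace X] [MulAction G X]
    (i : ℕ) (U : Subgroup G) : ModuleCat.{u} ℤ :=
  integralHomology i (Quotient (MulAction.orbitRel U X))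

end

/-! The argument has an algebraic half and a topological half, joined by `ℤ[G]`-maps between
permutation modules.

Algebra. Let `R` be `ℤ_(p)` or `ℚ`, and let `P`, `Q` be the integral permutation modules on the two
sides of the relation. A relation over `R` is an isomorphism over `R` between the two sides after
adding some lattice `L` to both. Clearing denominators gives integral maps `Λ × P ⇄ Λ × Q` that are
mutually inverse up to an integer `N`, where `N` is prime to `p` in the first case, and merely
nonzero in the second, where `p ∤ #G`. Let `p ^ v` be the exact power of `p` dividing `#G`. The two
sides become isomorphic modulo `p ^ (v + 1)`: trivially in the first case, and by a Brauer–Nesbitt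
argument with `v = 0` in the second. The finite module `Λ / p ^ (v + 1)` is cancelled by Lovász's
counting of homomorphisms. Averaging over `G` (Maranda) then lifts the resulting isomorphism to maps
`P ⇄ Q` that are mutually inverse up to some `m` prime to `p` (`PermModule.exists_of_equiv`).

Topology. Singular simplices lift along coverings, so the singular set of `X/U` is the quotient by
`U` of that of `X`. Hence an invariant matrix `a`, i.e. a map `ℤ[G/U] → ℤ[G/V]`, acts on chains by
sending the class of `σ` to the sum over `hV` of `a(1, hV)` times the class of `h⁻¹σ`. This is
additive and compatible with composition, so the maps `P ⇄ Q` induce maps on homology whose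
composites are multiplication by `m`. On `p`-primary parts `m` is invertible. The formula for orders
follows because a finite torsion group and its `p`-primary part have orders with the same `p`-adic
valuation. -/

noncomputable section

/-! ### Cancellation of finite modules -/

section Cancellation

variable {A : Type*} [Ring A]

/-- A linear map is a submodule together with an injective linear map on the quotient. -/
noncomputable def LinearMap.equivSigmaInjective (X P : Type*) [AddCommGroup X] [Module A X]
    [AddCommGroup P] [Module A P] :
    (Σ K : Submodule A X, {f : (X ⧸ K) →ₗ[A] P // Function.Injective f}) ≃ (X →ₗ[A] P) :=
  .ofBijective (fun F => F.2.1 ∘ₗ F.1.mkQ) <| by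
    constructor
    · rintro ⟨K, f, hf⟩ ⟨K', f', hf'⟩ h
      dsimp only at h
      have hK : K = K' := by
        have := congrArg LinearMap.ker h
        rwa [LinearMap.ker_comp, LinearMap.ker_comp, LinearMap.ker_eq_bot.mpr hf,
          LinearMap.ker_eq_bot.mpr hf', Submodule.comap_bot, Submodule.comap_bot,
          Submodule.ker_mkQ, Submodule.ker_mkQ] at this
      subst hK
      have : f = f' := Submodule.linearMap_qext _ h
      subst this
      rfl
    · intro f
      refine ⟨⟨LinearMap.ker f, (LinearMap.ker f).liftQ f le_rfl, ?_⟩, ?_⟩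
      · exact LinearMap.ker_eq_bot.mp (Submodule.ker_liftQ_eq_bot _ _ _ le_rfl)
      · exact Submodule.liftQ_mkQ _ _ _

/-- Sorting maps by their kernel gives `#Hom(X, P) = ∑ K, #Inj(X/K, P)`, and likewise for `Q`. The
terms with `K ≠ 0` agree by strong induction on `n = #X`, so the term `K = 0` agrees as well. -/
theorem card_injective_linearMap_eq {P Q : Type v} [AddCommGroup P] [Module A P] [Finite P]
    [AddCommGroup Q] [Module A Q] [Finite Q]
    (h : ∀ (X : Type v) [AddCommGroup X] [Module A X] [Finite X],
      Nat.card (X →ₗ[A] P) = Nat.card (X →ₗ[A] Q)) (n : ℕ) :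
    ∀ (X : Type v) [AddCommGroup X] [Module A X] [Finite X], Nat.card X = n →
      Nat.card {f : X →ₗ[A] P // Function.Injective f} =
        Nat.card {f : X →ₗ[A] Q // Function.Injective f} := by
  classical
  induction n using Nat.strong_induction_on with
  | _ n ih =>
  intro X _ _ _ hX
  have key : ∀ (Z : Type v) [AddCommGroup Z] [Module A Z],
      Nat.card {f : (X ⧸ (⊥ : Submodule A X)) →ₗ[A] Z // Function.Injective f} =
        Nat.card {f : X →ₗ[A] Z // Function.Injective f} := fun Z _ _ =>
    Nat.card_congr ((Equiv.subtypeEquiv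
      ((Submodule.quotEquivOfEqBot ⊥ rfl).congrLeft Z ℤ).toEquiv
      fun f => ((Submodule.quotEquivOfEqBot (⊥ : Submodule A X) rfl).symm.toEquiv.injective_comp
        f).symm))
  have hquot : ∀ K : Submodule A X, Finite (X ⧸ K) := fun K =>
    Finite.of_surjective _ K.mkQ_surjective
  have hfin : ∀ (Z : Type v) [AddCommGroup Z] [Module A Z] [Finite Z] (K : Submodule A X),
      Finite ((X ⧸ K) →ₗ[A] Z) := fun Z _ _ _ K => DFunLike.finite _
  have := hfin P
  have := hfin Q
  cases nonempty_fintype (Submodule A X)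
  have e := h X
  rw [← Nat.card_congr (LinearMap.equivSigmaInjective X P),
    ← Nat.card_congr (LinearMap.equivSigmaInjective X Q), Nat.card_sigma, Nat.card_sigma,
    ← Finset.add_sum_erase _ _ (Finset.mem_univ ⊥),
    ← Finset.add_sum_erase _ _ (Finset.mem_univ ⊥), key P, key Q] at e
  refine Nat.add_right_cancel (e.trans (congrArg _ (Finset.sum_congr rfl fun K hK => ?_)).symm)
  refine ih (Nat.card (X ⧸ K)) ?_ _ rfl
  obtain ⟨x, hx, hx0⟩ := Submodule.exists_mem_ne_zero_of_ne_bot (Finset.ne_of_mem_erase hK)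
  rw [← hX]
  refine lt_of_not_ge fun hle => hx0
    ((K.mkQ_surjective.bijective_of_nat_card_le hle).injective ?_)
  simpa using hx

/-- Finite modules can be cancelled from direct sums of finite modules (Lovász). -/
theorem nonempty_linearEquiv_of_prod {L P Q : Type v} [AddCommGroup L] [Module A L] [Finite L]
    [AddCommGroup P] [Module A P] [Finite P] [AddCommGroup Q] [Module A Q] [Finite Q]
    (e : (L × P) ≃ₗ[A] (L × Q)) : Nonempty (P ≃ₗ[A] Q) := by
  have h : ∀ (X : Type v) [AddCommGroup X] [Module A X] [Finite X],
      Nat.card (X →ₗ[A] P) = Nat.card (X →ₗ[A] Q) := by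
    intro X _ _ _
    have : Finite (X →ₗ[A] L) := DFunLike.finite _
    -- `Hom(X, L × P)` is `Hom(X, L) × Hom(X, P)`, and the factor `#Hom(X, L)` is finite and
    -- positive, so it cancels.
    have := Nat.card_congr (Equiv.trans
      (LinearMap.prodEquiv (R := A) ℤ (M := X) (M₂ := L) (M₃ := P)).toEquiv
      (Equiv.trans ⟨fun f => e.toLinearMap ∘ₗ f, fun f => e.symm.toLinearMap ∘ₗ f,
        fun f => by ext <;> simp, fun f => by ext <;> simp⟩ (LinearMap.prodEquiv ℤ).symm.toEquiv))
    rw [Nat.card_prod, Nat.card_prod] at this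
    exact Nat.eq_of_mul_eq_mul_left Nat.card_pos this
  have hP := card_injective_linearMap_eq h _ P rfl
  have hQ := card_injective_linearMap_eq h _ Q rfl
  have : Finite (P →ₗ[A] P) := DFunLike.finite _
  have : Finite (Q →ₗ[A] Q) := DFunLike.finite _
  -- The identities are injective, so the equal counts yield injections `P → Q` and `Q → P`;
  -- finiteness makes the first of them bijective.
  have : Nonempty {f : P →ₗ[A] P // Function.Injective f} := ⟨LinearMap.id, fun _ _ h => h⟩
  have : Nonempty {f : Q →ₗ[A] Q // Function.Injective f} := ⟨LinearMap.id, fun _ _ h => h⟩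
  have hP' := Nat.card_pos (α := {f : P →ₗ[A] P // Function.Injective f})
  have hQ' := Nat.card_pos (α := {f : Q →ₗ[A] Q // Function.Injective f})
  rw [hP] at hP'
  rw [← hQ] at hQ'
  obtain ⟨⟨f, hf⟩⟩ := (Nat.card_pos_iff.mp hP').1
  obtain ⟨⟨g, hg⟩⟩ := (Nat.card_pos_iff.mp hQ').1
  exact ⟨.ofBijective f (hf.bijective_of_nat_card_le (Nat.card_le_card_of_injective g hg))⟩

end Cancellation

/-! ### Reduction modulo an integer -/

section Reduction

variable (A : Type*) [Ring A] (q : ℕ)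

/-- The reduction `M / qM` of a module. -/
abbrev ModQuot (M : Type*) [AddCommGroup M] [Module A M] : Type _ :=
  M ⧸ LinearMap.range (q • (LinearMap.id : M →ₗ[A] M))

variable {A q} {M N L : Type*} [AddCommGroup M] [Module A M] [AddCommGroup N] [Module A N]
  [AddCommGroup L] [Module A L]

namespace ModQuot

variable (A q) in
/-- The reduction map `M → M / qM`. -/
abbrev mk (x : M) : ModQuot A q M := Submodule.Quotient.mk x

theorem mk_surjective : Function.Surjective (mk A q : M → ModQuot A q M) :=
  Submodule.Quotient.mk_surjective _

theorem mk_eq_zero {x : M} : mk A q x = 0 ↔ ∃ y, x = q • y := by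
  refine (Submodule.Quotient.mk_eq_zero _).trans ?_
  simp [eq_comm]

theorem mk_eq_mk {x y : M} : mk A q x = mk A q y ↔ ∃ z, x = y + q • z := by
  rw [← sub_eq_zero, ← Submodule.Quotient.mk_sub, mk_eq_zero]
  simp [sub_eq_iff_eq_add']

theorem smul_eq_zero (x : ModQuot A q M) : q • x = 0 := by
  obtain ⟨x, rfl⟩ := mk_surjective x
  exact mk_eq_zero.mpr ⟨x, rfl⟩

/-- The map between reductions induced by a linear map. -/
def map (f : M →ₗ[A] N) : ModQuot A q M →ₗ[A] ModQuot A q N :=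
  Submodule.mapQ _ _ f <| by
    rintro _ ⟨x, rfl⟩
    exact ⟨f x, by simp⟩

@[simp]
theorem map_mk (f : M →ₗ[A] N) (x : M) : map f (mk A q x) = mk A q (f x) := rfl

variable (A q M N) in
/-- Reduction commutes with binary products. -/
noncomputable def prodEquiv : ModQuot A q (M × N) ≃ₗ[A] ModQuot A q M × ModQuot A q N :=
  .ofBijective ((map (LinearMap.fst A M N)).prod (map (LinearMap.snd A M N))) <| by
    constructor
    · rw [injective_iff_map_eq_zero]
      intro x hx
      obtain ⟨⟨x, y⟩, rfl⟩ := mk_surjective x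
      obtain ⟨h₁, h₂⟩ := Prod.ext_iff.mp hx
      obtain ⟨a, ha⟩ := mk_eq_zero.mp h₁
      obtain ⟨b, hb⟩ := mk_eq_zero.mp h₂
      exact mk_eq_zero.mpr ⟨(a, b), Prod.ext ha hb⟩
    · rintro ⟨x, y⟩
      obtain ⟨x, rfl⟩ := mk_surjective x
      obtain ⟨y, rfl⟩ := mk_surjective y
      exact ⟨mk A q (x, y), rfl⟩

theorem finite (hq : q ≠ 0) [Module.Finite ℤ M] : Finite (ModQuot A q M) := by
  have key : ∀ {V : Type _} [AddCommGroup V] (f : M →+ V), Function.Surjective f →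
      (∀ x : V, q • x = 0) → Finite V := by
    intro V _ f hf hV
    have := Module.Finite.of_surjective f.toIntLinearMap hf
    refine Module.finite_of_fg_torsion V fun x => ⟨⟨(q : ℤ), by simpa using hq⟩, ?_⟩
    rw [Submonoid.mk_smul, natCast_zsmul, hV]
  exact key (Submodule.mkQ _ : M →ₗ[A] ModQuot A q M).toAddMonoidHom mk_surjective smul_eq_zero

/-- Maps that are mutually inverse up to an integer prime to `q` induce isomorphisms of the
reductions modulo `q`. -/
theorem nonempty_equiv_of_coprime {k : ℕ} (hk : k.Coprime q) (f : N →ₗ[A] M) (g : M →ₗ[A] N)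
    (hfg : ∀ x, f (g x) = k • x) (hgf : ∀ x, g (f x) = k • x) :
    Nonempty (ModQuot A q N ≃ₗ[A] ModQuot A q M) := by
  -- With `u * k + v * q = 1`, the map `u • g` is inverse to `f` modulo `q`.
  obtain ⟨u, v, huv⟩ := Nat.isCoprime_iff_coprime.mpr hk
  refine ⟨.ofBijective (map f) ⟨(injective_iff_map_eq_zero _).mpr fun x hx => ?_, fun y => ?_⟩⟩
  · obtain ⟨x, rfl⟩ := mk_surjective x
    obtain ⟨y, hy⟩ := mk_eq_zero.mp hx
    refine mk_eq_zero.mpr ⟨u • g y + v • x, ?_⟩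
    have h : k • x = q • g y := by rw [← hgf, hy, map_nsmul]
    calc x = (u * k + v * q) • x := by rw [huv, one_smul]
      _ = u • (k • x) + v • (q • x) := by simp only [add_smul, mul_smul, natCast_zsmul]
      _ = _ := by rw [h, smul_add, smul_comm u q, smul_comm v q]
  · obtain ⟨y, rfl⟩ := mk_surjective y
    refine ⟨mk A q (u • g y), mk_eq_mk.mpr ⟨- v • y, ?_⟩⟩
    rw [map_zsmul, hfg]
    calc u • k • y = (u * k + v * q) • y - v • (q • y) := by
          simp only [add_smul, mul_smul, natCast_zsmul, add_sub_cancel_right]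
      _ = _ := by rw [huv, one_smul, neg_smul, smul_neg, smul_comm v q, sub_eq_add_neg]

end ModQuot

end Reduction

/-! ### Maschke's theorem and the Brauer–Nesbitt argument -/

section BrauerNesbitt

variable {G : Type*} [Group G] [Finite G] {p : ℕ} [Fact p.Prime]

/-- Maschke's theorem for `ℤ[G]`-modules killed by a prime not dividing the order of `G`. -/
theorem exists_isCompl_of_smul_eq_zero (hp : ¬ p ∣ Nat.card G) {V : Type*} [AddCommGroup V]
    [Module ℤ[G] V] (hV : ∀ x : V, p • x = 0) (W : Submodule ℤ[G] V) : ∃ W', IsCompl W W' := by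
  cases nonempty_fintype G
  let := AddCommGroup.zmodModule hV
  let := AddCommGroup.zmodModule (n := p) (G := W) fun x => Subtype.ext (hV x)
  obtain ⟨π, hπ⟩ := (W.subtype.toAddMonoidHom.toZModLinearMap p).exists_leftInverse_of_injective
    (LinearMap.ker_eq_bot.mpr W.injective_subtype)
  let π' : V →ₗ[ℤ] W := π.toAddMonoidHom.toIntLinearMap
  have hπ' : ∀ v : W, π' (W.subtype v) = v := fun v => LinearMap.congr_fun hπ v
  -- Here `u` inverts `#G` modulo `p`, so `u` times the sum of the conjugates of `π` is the averaged
  -- projection.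
  obtain ⟨u, v, huv⟩ := Nat.isCoprime_iff_coprime.mpr
    ((Fact.out : p.Prime).coprime_iff_not_dvd.mpr hp).symm
  refine ⟨_, LinearMap.isCompl_of_proj (f := u • π'.sumOfConjugatesEquivariant G) fun x => ?_⟩
  rw [LinearMap.smul_apply, LinearMap.sumOfConjugatesEquivariant_apply]
  have h : ∀ g : G, π'.conjugate g (x : V) = x := fun g => π'.conjugate_i W.subtype hπ' g x
  simp only [h, Finset.sum_const, Finset.card_univ]
  have hx : p • x = 0 := Subtype.ext (hV x)
  calc u • Fintype.card G • x = (u * Nat.card G + v * p) • x := by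
        rw [add_smul, mul_smul, mul_smul, natCast_zsmul, natCast_zsmul, hx, smul_zero, add_zero,
          Nat.card_eq_fintype_card]
    _ = x := by rw [huv, one_smul]

/-- By Maschke the kernel has a complement, which `f` identifies with the range. -/
theorem nonempty_equiv_ker_prod_range (hp : ¬ p ∣ Nat.card G) {V W : Type*} [AddCommGroup V]
    [Module ℤ[G] V] [AddCommGroup W] [Module ℤ[G] W] (hV : ∀ x : V, p • x = 0)
    (f : V →ₗ[ℤ[G]] W) : Nonempty (V ≃ₗ[ℤ[G]] (LinearMap.ker f × LinearMap.range f)) := by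
  obtain ⟨C, hC⟩ := exists_isCompl_of_smul_eq_zero hp hV (LinearMap.ker f)
  exact ⟨(Submodule.prodEquivOfIsCompl _ _ hC).symm.trans ((LinearEquiv.refl _ _).prodCongr
    ((Submodule.quotientEquivOfIsCompl _ _ hC).symm.trans f.quotKerEquivRange))⟩

/-- Lattices `pM ⊆ N ⊆ M` have isomorphic reductions. -/
theorem ModQuot.nonempty_equiv_of_comp_eq (hp : ¬ p ∣ Nat.card G) {M N : Type v} [AddCommGroup M]
    [Module ℤ[G] M] [AddCommGroup N] [Module ℤ[G] N] (hM : ∀ x : M, p • x = 0 → x = 0)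
    (hN : ∀ x : N, p • x = 0 → x = 0) (f : N →ₗ[ℤ[G]] M) (g : M →ₗ[ℤ[G]] N)
    (hfg : ∀ x, f (g x) = p • x) (hgf : ∀ x, g (f x) = p • x) :
    Nonempty (ModQuot ℤ[G] p N ≃ₗ[ℤ[G]] ModQuot ℤ[G] p M) := by
  -- Exactness modulo `p`: if `g x = p y` then `p (x - f y) = 0`, so `x = f y` by torsion-freeness.
  -- Used in both directions, it exhibits both reductions as products of the same two ranges, in
  -- opposite order.
  have key : ∀ {M N : Type v} [AddCommGroup M] [Module ℤ[G] M] [AddCommGroup N] [Module ℤ[G] N]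
      (_ : ∀ x : M, p • x = 0 → x = 0) (f : N →ₗ[ℤ[G]] M) (g : M →ₗ[ℤ[G]] N)
      (_ : ∀ x, f (g x) = p • x) (_ : ∀ x, g (f x) = p • x),
      LinearMap.ker (map (q := p) g) = LinearMap.range (map (q := p) f) := by
    intro M N _ _ _ _ hM f g hfg hgf
    ext x
    obtain ⟨x, rfl⟩ := mk_surjective x
    rw [LinearMap.mem_ker, LinearMap.mem_range, map_mk, mk_eq_zero]
    constructor
    · rintro ⟨y, hy⟩
      refine ⟨mk _ _ y, ?_⟩
      have : p • (x - f y) = 0 := by rw [smul_sub, ← map_nsmul, ← hy, hfg, sub_self]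
      rw [map_mk, ← sub_eq_zero.mp (hM _ this)]
    · rintro ⟨y, hy⟩
      obtain ⟨y, rfl⟩ := mk_surjective y
      obtain ⟨z, hz⟩ := mk_eq_mk.mp hy.symm
      exact ⟨y + g z, by rw [hz, map_add, hgf, map_nsmul, smul_add]⟩
  obtain ⟨e₁⟩ := nonempty_equiv_ker_prod_range hp (ModQuot.smul_eq_zero (A := ℤ[G]))
    (map (q := p) f)
  obtain ⟨e₂⟩ := nonempty_equiv_ker_prod_range hp (ModQuot.smul_eq_zero (A := ℤ[G]))
    (map (q := p) g)
  rw [key hN g f hgf hfg] at e₁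
  rw [key hM f g hfg hgf] at e₂
  exact ⟨e₁.trans ((LinearEquiv.prodComm _ _ _).trans e₂.symm)⟩

/-- Lattices that are mutually contained in each other up to scaling have isomorphic reductions
modulo a prime not dividing the group order (Brauer–Nesbitt). -/
theorem ModQuot.nonempty_equiv_of_comp_eq_pow_mul (hp : ¬ p ∣ Nat.card G) {s : ℕ} (hs : s.Coprime p)
    (a : ℕ) : ∀ {M N : Type v} [AddCommGroup M] [Module ℤ[G] M] [AddCommGroup N] [Module ℤ[G] N]
    (_ : ∀ x : M, p • x = 0 → x = 0) (_ : ∀ x : N, p • x = 0 → x = 0)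
    (f : N →ₗ[ℤ[G]] M) (g : M →ₗ[ℤ[G]] N) (_ : Function.Injective f)
    (_ : ∀ x, f (g x) = (p ^ a * s) • x) (_ : ∀ x, g (f x) = (p ^ a * s) • x),
    Nonempty (ModQuot ℤ[G] p N ≃ₗ[ℤ[G]] ModQuot ℤ[G] p M) := by
  induction a with
  | zero =>
    intro M N _ _ _ _ hM hN f g hf hfg hgf
    exact nonempty_equiv_of_coprime hs f g (by simpa using hfg) (by simpa using hgf)
  | succ a ih =>
    intro M N _ _ _ _ hM hN f g hf hfg hgf
    -- Insert `M' = f(N) + pM` between `f(N)` and `M`. Then `pM ⊆ M' ⊆ M` is the basic case, while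
    -- `p ^ a * s` maps `M'` into `f(N)`, so the inductive hypothesis compares `N` with `M'`.
    let M' : Submodule ℤ[G] M :=
      LinearMap.range f ⊔ LinearMap.range (p • (LinearMap.id : M →ₗ[ℤ[G]] M))
    let f' : N →ₗ[ℤ[G]] M' := f.codRestrict M' fun x => Submodule.mem_sup_left ⟨x, rfl⟩
    let j : M →ₗ[ℤ[G]] M' := (p • (LinearMap.id : M →ₗ[ℤ[G]] M)).codRestrict M' fun x =>
      Submodule.mem_sup_right ⟨x, rfl⟩
    have hmem : ∀ x : M', (p ^ a * s) • (x : M) ∈ LinearMap.range f := by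
      rintro ⟨x, hx⟩
      obtain ⟨_, ⟨y, rfl⟩, _, ⟨z, rfl⟩, rfl⟩ := Submodule.mem_sup.mp hx
      refine ⟨(p ^ a * s) • y + g z, ?_⟩
      rw [map_add, hfg, map_nsmul, smul_add]
      simp only [LinearMap.smul_apply, LinearMap.id_apply, ← mul_smul]
      congr 2
      ring
    let g' : M' →ₗ[ℤ[G]] N := (LinearEquiv.ofInjective f hf).symm.toLinearMap ∘ₗ
      ((p ^ a * s) • M'.subtype).codRestrict (LinearMap.range f) hmem
    have hg' : ∀ x, f (g' x) = (p ^ a * s) • (x : M) := fun x =>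
      congrArg Subtype.val ((LinearEquiv.ofInjective f hf).apply_symm_apply
        (((p ^ a * s) • M'.subtype).codRestrict (LinearMap.range f) hmem x))
    have hM' : ∀ x : M', p • x = 0 → x = 0 := fun x hx =>
      Subtype.ext (hM _ (congrArg Subtype.val hx))
    obtain ⟨e₁⟩ := ih hM' hN f' g' (fun x y h => hf (congrArg Subtype.val h))
      (fun x => Subtype.ext (hg' x)) (fun x => hf (by rw [hg', map_nsmul]; rfl))
    obtain ⟨e₂⟩ := nonempty_equiv_of_comp_eq hp hM hM' M'.subtype j (fun x => rfl)
      (fun x => rfl)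
    exact ⟨e₁.trans e₂⟩

end BrauerNesbitt

/-! ### Lifting isomorphisms of reductions to lattices -/

section Lifting

/-- Nakayama: a map that is bijective modulo `p` is invertible up to an integer
prime to `p`. -/
theorem exists_coprime_inverse {p : ℕ} {A : Type*} [Ring A] {P Q : Type*} [AddCommGroup P]
    [Module A P] [AddCommGroup Q] [Module A Q] [Module.Finite ℤ Q]
    (f : P →ₗ[A] Q) (hf : Function.Injective f) (hsurj : ∀ y, ∃ x z, y = f x + p • z) :
    ∃ m : ℕ, m.Coprime p ∧ ∃ g : Q →ₗ[A] P, (∀ x, f (g x) = m • x) ∧ ∀ x, g (f x) = m • x := by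
  obtain ⟨m, hm, hmQ⟩ : ∃ m : ℕ, m.Coprime p ∧ ∀ y, m • y ∈ LinearMap.range f := by
    let f' : P →+ Q := f.toAddMonoidHom
    let C := Q ⧸ f'.range
    have : Module.Finite ℤ C := Module.Finite.of_surjective
      (QuotientAddGroup.mk' f'.range).toIntLinearMap (QuotientAddGroup.mk'_surjective _)
    -- Surjectivity modulo `p` says that the cokernel `C` satisfies `C = pC`; Nakayama gives `r ≡ 1`
    -- modulo `p` with `rC = 0`.
    obtain ⟨r, hr, hrC⟩ := Submodule.exists_sub_one_mem_and_smul_eq_zero_of_fg_of_le_smul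
      (Ideal.span {(p : ℤ)}) (⊤ : Submodule ℤ C) Module.Finite.fg_top (by
        rintro y -
        obtain ⟨y, rfl⟩ := QuotientAddGroup.mk'_surjective _ y
        obtain ⟨x, z, rfl⟩ := hsurj y
        have h : QuotientAddGroup.mk' f'.range (f x + p • z) =
            (p : ℤ) • QuotientAddGroup.mk' f'.range z := by
          rw [map_add, map_nsmul, natCast_zsmul, add_eq_right]
          exact (QuotientAddGroup.eq_zero_iff _).mpr ⟨x, rfl⟩
        rw [h]
        exact Submodule.smul_mem_smul (Ideal.mem_span_singleton_self _) Submodule.mem_top)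
    obtain ⟨c, hc⟩ := Ideal.mem_span_singleton.mp hr
    refine ⟨r.natAbs, ?_, fun y => ?_⟩
    · rw [Nat.Coprime, ← Int.natAbs_natCast p, ← Int.gcd_def, ← Int.isCoprime_iff_gcd_eq_one]
      exact ⟨1, -c, by linear_combination hc⟩
    · have hy : r • y ∈ LinearMap.range f := by
        obtain ⟨x, hx⟩ := (QuotientAddGroup.eq_zero_iff (N := f'.range) (r • y)).mp
          (hrC (QuotientAddGroup.mk' f'.range y) Submodule.mem_top)
        exact ⟨x, hx⟩
      rcases Int.natAbs_eq r with h | h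
      · rwa [h, natCast_zsmul] at hy
      · rw [h, neg_smul, natCast_zsmul] at hy
        exact (Submodule.neg_mem_iff _).mp hy
  let g : Q →ₗ[A] P := (LinearEquiv.ofInjective f hf).symm.toLinearMap ∘ₗ
      (m • LinearMap.id).codRestrict (LinearMap.range f) hmQ
  have hg : ∀ x, f (g x) = m • x := fun x =>
    congrArg Subtype.val ((LinearEquiv.ofInjective f hf).apply_symm_apply
      ((m • LinearMap.id).codRestrict (LinearMap.range f) hmQ x))
  exact ⟨m, hm, g, hg, fun x => hf (by rw [hg, map_nsmul])⟩

/-- An element of the kernel is `p z`, and `z` is again in the kernel because `Q` has no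
`p`-torsion. It is therefore divisible by every power of `p`, which a nonzero coordinate in a
`ℤ`-basis forbids. -/
theorem injective_of_injective_mod {p : ℕ} [Fact p.Prime] {P Q : Type*} [AddCommGroup P]
    [Module.Free ℤ P] [Module.Finite ℤ P] [AddCommGroup Q]
    (hQ : ∀ x : Q, p • x = 0 → x = 0) (f : P →+ Q)
    (hf : ∀ x y, f x = p • y → ∃ z, x = p • z) : Function.Injective f := by
  rw [injective_iff_map_eq_zero]
  intro x hx
  by_contra hx0
  have key : ∀ n : ℕ, ∃ z, x = p ^ n • z ∧ f z = 0 := by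
    intro n
    induction n with
    | zero => exact ⟨x, by simp, hx⟩
    | succ n ih =>
      obtain ⟨z, rfl, hz⟩ := ih
      obtain ⟨w, rfl⟩ := hf z 0 (by simpa using hz)
      exact ⟨w, by rw [pow_succ, mul_smul], hQ _ (by rw [← map_nsmul, hz])⟩
  let b := Module.Free.chooseBasis ℤ P
  obtain ⟨i, hi⟩ : ∃ i, b.repr x i ≠ 0 := by
    by_contra! h
    exact hx0 (b.repr.map_eq_zero_iff.mp (Finsupp.ext h))
  have hfin : FiniteMultiplicity (p : ℤ) (b.repr x i) := Int.finiteMultiplicity_iff.mpr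
    ⟨by simpa using (Fact.out : p.Prime).ne_one, hi⟩
  obtain ⟨n, hn⟩ := hfin
  obtain ⟨z, hz, -⟩ := key (n + 1)
  refine hn ⟨b.repr z i, ?_⟩
  rw [hz, map_nsmul, Finsupp.smul_apply, nsmul_eq_mul, Nat.cast_pow]

/-- An isomorphism modulo a sufficiently high power of `p` gives maps of `ℤ[G]`-lattices
that are mutually inverse up to an integer prime to `p` (Maranda). -/
theorem exists_of_modQuot_equiv {G : Type*} [Group G] [Finite G] {p : ℕ} [Fact p.Prime]
    {P Q : Type*} [AddCommGroup P] [Module ℤ[G] P]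
    [Module.Free ℤ P] [Module.Finite ℤ P] [AddCommGroup Q] [Module ℤ[G] Q] [Module.Free ℤ Q]
    [Module.Finite ℤ Q] {v u : ℕ} (hu : u.Coprime p) (hG : Nat.card G = p ^ v * u)
    (e : ModQuot ℤ[G] (p ^ (v + 1)) P ≃ₗ[ℤ[G]] ModQuot ℤ[G] (p ^ (v + 1)) Q) :
    ∃ m : ℕ, m.Coprime p ∧ ∃ (f : P →ₗ[ℤ[G]] Q) (g : Q →ₗ[ℤ[G]] P),
      (∀ x, f (g x) = m • x) ∧ ∀ x, g (f x) = m • x := by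
  cases nonempty_fintype G
  have hp0 : p ≠ 0 := (Fact.out : p.Prime).ne_zero
  have htf : ∀ {n : ℕ} (_ : n ≠ 0) {x y : Q}, n • x = n • y → x = y := fun {n} hn {x y} h =>
    smul_right_injective Q (r := (n : ℤ)) (by exact_mod_cast hn)
      (by simpa only [natCast_zsmul] using h)
  -- Lifting `e` on a `ℤ`-basis gives an additive map that is `G`-equivariant only modulo `p ^ (v +
  -- 1)`.
  obtain ⟨f₀, hf₀⟩ : ∃ f₀ : P →ₗ[ℤ] Q, ∀ x, ModQuot.mk ℤ[G] (p ^ (v + 1)) (f₀ x) =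
      e (ModQuot.mk ℤ[G] (p ^ (v + 1)) x) := by
    let b := Module.Free.chooseBasis ℤ P
    choose y hy using fun i => ModQuot.mk_surjective (e (ModQuot.mk ℤ[G] (p ^ (v + 1)) (b i)))
    refine ⟨b.constr ℤ y, fun x => ?_⟩
    let l : P →+ ModQuot ℤ[G] (p ^ (v + 1)) Q :=
      (Submodule.mkQ _ : Q →ₗ[ℤ[G]] ModQuot ℤ[G] (p ^ (v + 1)) Q).toAddMonoidHom.comp
        (b.constr ℤ y).toAddMonoidHom
    let r : P →+ ModQuot ℤ[G] (p ^ (v + 1)) Q := e.toLinearMap.toAddMonoidHom.comp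
      (Submodule.mkQ _ : P →ₗ[ℤ[G]] ModQuot ℤ[G] (p ^ (v + 1)) P).toAddMonoidHom
    have : l.toIntLinearMap = r.toIntLinearMap := b.ext fun i =>
      (congrArg (ModQuot.mk ℤ[G] (p ^ (v + 1))) (b.constr_basis ℤ y i)).trans (hy i)
    exact LinearMap.congr_fun this x
  have hconj : ∀ (g : G) (x : P), ∃ z, f₀.conjugate g x = f₀ x + p ^ (v + 1) • z := by
    intro g x
    rw [← ModQuot.mk_eq_mk (A := ℤ[G]), LinearMap.conjugate_apply, hf₀]
    change MonoidAlgebra.single g⁻¹ (1 : ℤ) • ModQuot.mk ℤ[G] _ (f₀ _) = _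
    rw [hf₀, ← map_smul]
    change e (ModQuot.mk ℤ[G] _ (_ • _ • x)) = _
    rw [smul_smul, MonoidAlgebra.single_mul_single, inv_mul_cancel, mul_one,
      ← MonoidAlgebra.one_def, one_smul]
  choose c hc using hconj
  -- The sum of the conjugates is `#G • f₀` plus a multiple of `p ^ (v + 1)`. It is thus divisible
  -- by `p ^ v`, and one factor `p` is left over in the error term.
  have hsum : ∀ x, f₀.sumOfConjugatesEquivariant G x =
      p ^ v • (u • f₀ x + p • ∑ g, c g x) := by
    intro x
    rw [LinearMap.sumOfConjugatesEquivariant_apply]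
    simp only [hc, Finset.sum_add_distrib, Finset.sum_const, Finset.card_univ,
      ← Finset.smul_sum]
    rw [← Nat.card_eq_fintype_card, hG, smul_add, mul_smul, smul_smul _ p, ← pow_succ]
  -- Division by `p ^ v` keeps `ℤ[G]`-linearity since `Q` is torsion-free. The quotient `f` is `u •
  -- f₀` modulo `p` with `u` prime to `p`, so `f` is bijective modulo `p` like `e`.
  obtain ⟨f, hf⟩ : ∃ f : P →ₗ[ℤ[G]] Q, ∀ x, f x = u • f₀ x + p • ∑ g, c g x := by
    refine ⟨⟨⟨fun x => u • f₀ x + p • ∑ g, c g x, fun x y => ?_⟩, fun a x => ?_⟩, fun x => rfl⟩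
    · refine htf (pow_ne_zero v hp0) ?_
      rw [smul_add (p ^ v) (u • f₀ x + _), ← hsum, ← hsum, ← hsum, map_add]
    · refine htf (pow_ne_zero v hp0) ?_
      rw [← hsum, map_smul, hsum, RingHom.id_apply, smul_comm]
  obtain ⟨k, l, hkl⟩ := Nat.isCoprime_iff_coprime.mpr hu
  have hQ : ∀ x : Q, p • x = 0 → x = 0 := fun x hx => htf hp0 (by rw [hx, smul_zero])
  have hinj : ∀ x y, f x = p • y → ∃ z, x = p • z := by
    intro x y hxy
    rw [hf] at hxy
    obtain ⟨w, hw⟩ : ∃ w, f₀ x = p • w := by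
      refine ⟨k • (y - ∑ g, c g x) + l • f₀ x, ?_⟩
      have h : u • f₀ x = p • (y - ∑ g, c g x) := by rw [smul_sub, ← hxy, add_sub_cancel_right]
      calc f₀ x = (k * u + l * p) • f₀ x := by rw [hkl, one_smul]
        _ = k • u • f₀ x + l • p • f₀ x := by simp only [add_smul, mul_smul, natCast_zsmul]
        _ = _ := by rw [h, smul_add, smul_comm k p, smul_comm l p]
    obtain ⟨t, ht⟩ := ModQuot.mk_surjective (e.symm (ModQuot.mk ℤ[G] (p ^ (v + 1)) w))
    have h1 : e (ModQuot.mk ℤ[G] (p ^ (v + 1)) x) = e (ModQuot.mk ℤ[G] (p ^ (v + 1)) (p • t)) := by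
      have h2 : e (ModQuot.mk ℤ[G] (p ^ (v + 1)) t) = ModQuot.mk ℤ[G] (p ^ (v + 1)) w := by
        rw [ht, e.apply_symm_apply]
      rw [← hf₀, hw]
      change p • ModQuot.mk ℤ[G] (p ^ (v + 1)) w = e (p • ModQuot.mk ℤ[G] (p ^ (v + 1)) t)
      rw [map_nsmul, h2]
    obtain ⟨z, hz⟩ := ModQuot.mk_eq_mk.mp (e.injective h1)
    exact ⟨t + p ^ v • z, by rw [hz, smul_add, smul_smul, ← pow_succ']⟩
  have hsurj : ∀ y, ∃ x z, y = f x + p • z := by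
    intro y
    obtain ⟨x, hx⟩ := ModQuot.mk_surjective (e.symm (ModQuot.mk ℤ[G] (p ^ (v + 1)) y))
    have h2 : ModQuot.mk ℤ[G] (p ^ (v + 1)) (f₀ x) = ModQuot.mk ℤ[G] (p ^ (v + 1)) y := by
      rw [hf₀, hx, e.apply_symm_apply]
    obtain ⟨z, hz⟩ := ModQuot.mk_eq_mk.mp h2.symm
    refine ⟨k • x, p ^ v • z + l • f₀ x - ∑ g, c g (k • x), ?_⟩
    rw [hf, map_zsmul, smul_sub, smul_add, smul_smul, ← pow_succ']
    calc y = (k * u + l * p) • f₀ x + p ^ (v + 1) • z := by rw [hkl, one_smul, hz]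
      _ = k • u • f₀ x + l • p • f₀ x + p ^ (v + 1) • z := by
        simp only [add_smul, mul_smul, natCast_zsmul]
      _ = _ := by rw [smul_comm k u, smul_comm l p]; abel
  obtain ⟨m, hm, g, hfg, hgf⟩ := exists_coprime_inverse f
    (injective_of_injective_mod hQ f.toAddMonoidHom hinj) hsurj
  exact ⟨m, hm, f, g, hfg, hgf⟩

end Lifting

/-! ### Cancelling lattices and clearing denominators -/

section

variable {G : Type*} [Group G] [Finite G] {p : ℕ} [Fact p.Prime]

/-- Cancellation of a lattice `L` from maps `L × P ⇄ L × Q` that are mutually inverse up to an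
integer `N`, where `N` or the group order is prime to `p`. -/
theorem exists_coprime_inverse_of_prod {L P Q : Type v} [AddCommGroup L] [Module ℤ[G] L]
    [Module.Free ℤ L] [Module.Finite ℤ L] [AddCommGroup P] [Module ℤ[G] P]
    [Module.Free ℤ P] [Module.Finite ℤ P] [AddCommGroup Q] [Module ℤ[G] Q] [Module.Free ℤ Q]
    [Module.Finite ℤ Q] {N : ℕ} (hN : N ≠ 0) (h : N.Coprime p ∨ ¬ p ∣ Nat.card G)
    (f : (L × P) →ₗ[ℤ[G]] (L × Q)) (g : (L × Q) →ₗ[ℤ[G]] (L × P))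
    (hfg : ∀ x, f (g x) = N • x) (hgf : ∀ x, g (f x) = N • x) :
    ∃ m : ℕ, m.Coprime p ∧ ∃ (f : P →ₗ[ℤ[G]] Q) (g : Q →ₗ[ℤ[G]] P),
      (∀ x, f (g x) = m • x) ∧ ∀ x, g (f x) = m • x := by
  have hp : p.Prime := Fact.out
  have key : ∀ {v u : ℕ} (_ : u.Coprime p) (_ : Nat.card G = p ^ v * u),
      Nonempty (ModQuot ℤ[G] (p ^ (v + 1)) (L × P) ≃ₗ[ℤ[G]] ModQuot ℤ[G] (p ^ (v + 1)) (L × Q)) →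
      ∃ m : ℕ, m.Coprime p ∧ ∃ (f : P →ₗ[ℤ[G]] Q) (g : Q →ₗ[ℤ[G]] P),
        (∀ x, f (g x) = m • x) ∧ ∀ x, g (f x) = m • x := by
    rintro v u hu hG ⟨e⟩
    have hq : p ^ (v + 1) ≠ 0 := pow_ne_zero _ hp.ne_zero
    have := ModQuot.finite (A := ℤ[G]) (M := L) hq
    have := ModQuot.finite (A := ℤ[G]) (M := P) hq
    have := ModQuot.finite (A := ℤ[G]) (M := Q) hq
    obtain ⟨e'⟩ := nonempty_linearEquiv_of_prod
      ((ModQuot.prodEquiv ℤ[G] _ L P).symm.trans (e.trans (ModQuot.prodEquiv ℤ[G] _ L Q)))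
    exact exists_of_modQuot_equiv hu hG e'
  have htf : ∀ {M : Type v} [AddCommGroup M] [Module.Free ℤ M] {n : ℕ} (_ : n ≠ 0) (x : M),
      n • x = 0 → x = 0 := fun {M} _ _ {n} hn x hx => by
    rw [← natCast_zsmul] at hx
    exact (smul_eq_zero.mp hx).resolve_left (by exact_mod_cast hn)
  -- If `N` is prime to `p`, the maps already induce isomorphisms modulo every power of `p`.
  -- Otherwise `p ∤ #G`, so `v = 0` and only the reduction modulo `p` is needed.
  rcases h with h | h
  · obtain ⟨v, u, hu, hG⟩ := Nat.exists_eq_pow_mul_and_not_dvd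
      (Nat.card_pos (α := G)).ne' p hp.ne_one
    exact key ((hp.coprime_iff_not_dvd.mpr hu).symm) hG
      (ModQuot.nonempty_equiv_of_coprime (h.pow_right _) f g hfg hgf)
  · refine key (v := 0) ((hp.coprime_iff_not_dvd.mpr h).symm) (by simp) ?_
    obtain ⟨a, s, hs, rfl⟩ := Nat.exists_eq_pow_mul_and_not_dvd hN p hp.ne_one
    rw [zero_add, pow_one]
    refine ModQuot.nonempty_equiv_of_comp_eq_pow_mul h (hp.coprime_iff_not_dvd.mpr hs).symm a
      (htf hp.ne_zero) (htf hp.ne_zero) f g ((injective_iff_map_eq_zero f).mpr fun x hx => ?_)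
      hfg hgf
    exact htf hN x (by rw [← hgf, hx, map_zero])

/-- An isomorphism of `ℤ[G]`-modules restricts, up to scaling, to finitely generated submodules
of full rank. -/
theorem exists_smul_restrict {A : Type*} [Ring A] {V W M N : Type*} [AddCommGroup V] [Module A V]
    [AddCommGroup W] [Module A W] [AddCommGroup M] [Module A M] [Module.Finite ℤ M]
    [AddCommGroup N] [Module A N] (S : Submonoid ℕ) (Φ : V →ₗ[A] W)
    (i : M →ₗ[A] V) (j : N →ₗ[A] W) (hj : Function.Injective j)
    (h : ∀ w, ∃ s ∈ S, s • w ∈ LinearMap.range j) :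
    ∃ s ∈ S, ∃ f : M →ₗ[A] N, ∀ x, j (f x) = s • Φ (i x) := by
  obtain ⟨s, hs, hsM⟩ : ∃ s ∈ S, ∀ x ∈ (⊤ : Submodule ℤ M), s • Φ (i x) ∈ LinearMap.range j := by
    classical
    obtain ⟨t, ht⟩ := Module.Finite.fg_top (R := ℤ) (M := M)
    rw [← ht]
    clear ht
    -- The denominators of the finitely many generators are multiplied into a common one.
    induction t using Finset.induction_on with
    | empty => exact ⟨1, S.one_mem, fun x hx => by
        rw [Finset.coe_empty, Submodule.span_empty, Submodule.mem_bot] at hx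
        simp [hx]⟩
    | insert a t _ ih =>
      obtain ⟨s, hs, hst⟩ := ih
      obtain ⟨r, hr, hra⟩ := h (Φ (i a))
      refine ⟨s * r, S.mul_mem hs hr, fun x hx => ?_⟩
      rw [Finset.coe_insert, Submodule.mem_span_insert] at hx
      obtain ⟨c, z, hz, rfl⟩ := hx
      rw [map_add, map_add, smul_add, map_zsmul, map_zsmul, smul_comm _ c, mul_smul, mul_comm s r,
        mul_smul]
      exact add_mem (zsmul_mem (nsmul_mem hra _) _) (nsmul_mem (hst z hz) _)
  let F : M →ₗ[A] LinearMap.range j := (s • (Φ ∘ₗ i)).codRestrict _ fun x => hsM x trivial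
  refine ⟨s, hs, (LinearEquiv.ofInjective j hj).symm.toLinearMap ∘ₗ F, fun x => ?_⟩
  exact congrArg Subtype.val ((LinearEquiv.ofInjective j hj).apply_symm_apply (F x))

/-- If every scalar of `R` has an integral multiple by an element of `S`, then every vector has
a multiple in a subgroup containing a spanning set. -/
theorem exists_smul_mem_of_span {R V : Type*} [Ring R] [AddCommGroup V] [Module R V]
    (S : Submonoid ℕ) (hR : ∀ r : R, ∃ s ∈ S, ∃ z : ℤ, (s : R) * r = z) (B : Set V)
    (hB : Submodule.span R B = ⊤) (N : AddSubgroup V) (hN : B ⊆ N) (x : V) :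
    ∃ s ∈ S, s • x ∈ N := by
  have hx : x ∈ Submodule.span R B := hB ▸ Submodule.mem_top
  induction hx using Submodule.span_induction with
  | mem x hx => exact ⟨1, S.one_mem, by simpa using hN hx⟩
  | zero => exact ⟨1, S.one_mem, by simp⟩
  | add x y _ _ hx hy =>
    obtain ⟨s, hs, hsx⟩ := hx
    obtain ⟨t, ht, hty⟩ := hy
    refine ⟨s * t, S.mul_mem hs ht, ?_⟩
    rw [smul_add, mul_smul s t y, mul_comm, mul_smul]
    exact add_mem (nsmul_mem hsx _) (nsmul_mem hty _)
  | smul r x _ hx =>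
    obtain ⟨s, hs, hsx⟩ := hx
    obtain ⟨t, ht, z, hz⟩ := hR r
    refine ⟨s * t, S.mul_mem hs ht, ?_⟩
    have : t • r • x = z • x := by
      rw [← Nat.cast_smul_eq_nsmul R, smul_smul, hz, Int.cast_smul_eq_zsmul]
    rw [mul_smul, this, smul_comm]
    exact zsmul_mem hsx _

end

/-- The product of a family of representations. -/
def Representation.piFamily {R G ι : Type*} [CommSemiring R] [Monoid G] {V : ι → Type*}
    [∀ a, AddCommMonoid (V a)] [∀ a, Module R (V a)] (ρ : ∀ a, Representation R G (V a)) :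
    Representation R G (∀ a, V a) where
  toFun g := LinearMap.pi fun a => ρ a g ∘ₗ LinearMap.proj a
  map_one' := by ext; simp
  map_mul' g h := by ext; simp

/-! ### Relations as stable isomorphisms -/

namespace RepLattice

variable {R : Type u} [CommRing R] {G : Type v} [Group G]

/-- The product of a finite family of lattices. -/
def pi {ι : Type} [Finite ι] (M : ι → RepLattice R G) : RepLattice R G where
  carrier := ∀ a, (M a).carrier
  rep := Representation.piFamily fun a => (M a).rep

theorem isoClass_pi {ι : Type} [Fintype ι] (M : ι → RepLattice R G) :
    (pi M).isoClass = ∑ a, (M a).isoClass := by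
  refine Finite.induction_empty_option
    (P := fun ι => ∀ (_ : Finite ι) (_ : Fintype ι) (M : ι → RepLattice R G),
      (pi M).isoClass = ∑ a, (M a).isoClass) ?_ ?_ ?_ ι inferInstance inferInstance M
  · intro α β e ih _ _ M
    have := Finite.of_equiv β e.symm
    cases nonempty_fintype α
    rw [← e.sum_comp, ← ih this inferInstance]
    exact Quotient.sound (equiv_of_linearEquiv (M := pi M) (N := pi fun a => M (e a))
      (LinearEquiv.piCongrLeft R (fun b => (M b).carrier) e).symm fun g x => rfl)
  · intro _ _ M
    rw [Fintype.sum_empty]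
    have : Unique (pi M).carrier := inferInstanceAs (Unique (∀ a : PEmpty, (M a).carrier))
    exact Quotient.sound (equiv_of_linearEquiv (M := pi M) (N := zero R G)
      (LinearEquiv.ofSubsingleton (pi M).carrier PUnit.{max u v + 1}) fun g x => rfl)
  · intro α _ ih _ hα M
    obtain rfl := Subsingleton.elim hα instFintypeOption
    rw [Fintype.sum_option, ← ih inferInstance inferInstance, isoClass_add]
    exact Quotient.sound (equiv_of_linearEquiv (M := pi M)
      (N := (M none).prod (pi fun a => M (some a)))
      { (Equiv.piOptionEquivProd (β := fun a => (M a).carrier)) with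
        map_add' := fun _ _ => rfl
        map_smul' := fun _ _ => rfl } fun g x => rfl)

theorem nonempty_equiv_of_isoClass_eq {M N : RepLattice R G} (h : M.isoClass = N.isoClass) :
    ∃ e : M.carrier ≃ₗ[R] N.carrier, ∀ g x, e (M.rep g x) = N.rep g (e x) := by
  obtain ⟨e⟩ := Quotient.exact h
  exact ⟨e.toLinearEquiv, e.toIntertwiningMap.isIntertwining⟩

end RepLattice

/-- The permutation lattice of `G ⧸ U`. -/
abbrev cosetLattice (R : Type u) [CommRing R] {G : Type v} [Group G] [Finite G] (U : Subgroup G) :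
    RepLattice R G :=
  permLattice R { carrier := G ⧸ U }

/-- A relation yields a stable isomorphism of permutation lattices. -/
theorem IsRelation.exists_equiv {R : Type u} [CommRing R] {G : Type v} [Group G] [Finite G]
    {J K : Type} [Finite J] [Finite K] {U : J → Subgroup G} {U' : K → Subgroup G}
    [Fintype J] [Fintype K]
    (h : IsRelation R (∑ j, burnsideOf (U j) - ∑ k, burnsideOf (U' k))) :
    ∃ (L : RepLattice R G) (e : (L.carrier × ∀ j, R[G ⧸ U j]) ≃ₗ[R] (L.carrier × ∀ k, R[G ⧸ U' k])),
      ∀ g x, e (L.rep.prod (.piFamily fun j => .ofMulAction R G (G ⧸ U j)) g x) =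
        L.rep.prod (.piFamily fun k => .ofMulAction R G (G ⧸ U' k)) g (e x) := by
  have hof : ∀ V : Subgroup G, burnsideToRep R (burnsideOf V) =
      Algebra.GrothendieckAddGroup.of (cosetLattice R V).isoClass := fun V =>
    FreeAbelianGroup.lift_apply_of _ _
  rw [IsRelation, AddMonoidHom.mem_ker, map_sub, sub_eq_zero, map_sum, map_sum] at h
  simp only [hof] at h
  rw [← map_sum, ← map_sum, ← RepLattice.isoClass_pi, ← RepLattice.isoClass_pi] at h
  -- Equality in the Grothendieck group means equality of classes only after adding some class `c`;
  -- this is the source of `L`.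
  obtain ⟨⟨c, _⟩, hL⟩ := AddSubmonoid.LocalizationMap.exists_of_eq _ h
  obtain ⟨L, rfl⟩ := Quotient.exists_rep c
  obtain ⟨e, he⟩ := RepLattice.nonempty_equiv_of_isoClass_eq hL
  exact ⟨L, e, he⟩

/-! ### Integral permutation modules -/

namespace Representation

variable {G : Type v} [Group G]

/-- The underlying integral representation. -/
def toInt {R V : Type*} [CommRing R] [AddCommGroup V] [Module R V] (ρ : Representation R G V) :
    Representation ℤ G V where
  toFun g := (ρ g).toAddMonoidHom.toIntLinearMap
  map_one' := by ext; simp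
  map_mul' g h := by ext; simp

/-- An equivariant additive map as a map of `ℤ[G]`-modules. -/
def asModuleHom {V W : Type*} [AddCommGroup V] [AddCommGroup W] (ρ : Representation ℤ G V)
    (σ : Representation ℤ G W) (f : V →+ W) (h : ∀ g x, f (ρ g x) = σ g (f x)) :
    ρ.asModule →ₗ[ℤ[G]] σ.asModule :=
  MonoidAlgebra.equivariantOfLinearOfComm
    (σ.asModuleEquiv.symm.toLinearMap ∘ₗ f.toIntLinearMap ∘ₗ ρ.asModuleEquiv.toLinearMap)
    fun g v => by
      simp only [single_smul, one_smul]
      exact h g v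

end Representation

section

variable {G : Type v} [Group G]

/-- The permutation module `ℤ[T]` of a `G`-set `T`. -/
abbrev PermModule (G : Type v) [Group G] (T : Type v) [MulAction G T] : Type v :=
  (Representation.ofMulAction ℤ G T).asModule

namespace PermModule

variable {T T' : Type v} [MulAction G T'] [MulAction G T]

/-- The coefficient of an element of a permutation module. -/
def coeff (x : PermModule G T) (t : T) : ℤ := MonoidAlgebra.coeff (R := ℤ) (M := T) x t

variable (G) in
/-- The basis vector attached to an element of a `G`-set. -/
def single (t : T) : PermModule G T := MonoidAlgebra.single (R := ℤ) (M := T) t 1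

theorem single_smul_single (g : G) (t : T) :
    MonoidAlgebra.single g (1 : ℤ) • single G t = single G (g • t) := by
  rw [Representation.single_smul, one_smul]
  exact Representation.ofMulAction_single g t 1

theorem coeff_single_smul (g : G) (x : PermModule G T) (t : T) :
    coeff (MonoidAlgebra.single g (1 : ℤ) • x) (g • t) = coeff x t := by
  rw [Representation.single_smul, one_smul]
  refine (Representation.coeff_ofMulAction g (H := T) _ _).trans ?_
  rw [inv_smul_smul]
  rfl

theorem coeff_single [DecidableEq T] (t t' : T) :
    coeff (single G t) t' = if t = t' then 1 else 0 := by
  classical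
  exact Finsupp.single_apply.trans (by congr)

theorem coeff_nsmul (n : ℕ) (x : PermModule G T) (t : T) : coeff (n • x) t = n * coeff x t := by
  have : coeff (n • x) t = n • coeff x t := rfl
  rw [this, nsmul_eq_mul]

theorem eq_sum [Fintype T] (x : PermModule G T) : x = ∑ t, coeff x t • single G t := by
  have h : ∀ y : ℤ[T], y = ∑ t, y.coeff t • MonoidAlgebra.single t 1 := by
    intro y
    classical
    ext t
    simp
  exact h x

theorem coeff_map [Fintype T] (f : PermModule G T →ₗ[ℤ[G]] PermModule G T')
    (x : PermModule G T) (t' : T') :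
    coeff (f x) t' = ∑ t, coeff x t * coeff (f (single G t)) t' := by
  let c : PermModule G T' →+ ℤ := ⟨⟨fun x => coeff x t', rfl⟩, fun _ _ => rfl⟩
  change c (f x) = ∑ t, coeff x t * c (f (single G t))
  conv_lhs => rw [eq_sum x]
  simp only [map_sum, map_zsmul, smul_eq_mul]

theorem coeff_map_smul (f : PermModule G T →ₗ[ℤ[G]] PermModule G T') (g : G) (t : T) (t' : T') :
    coeff (f (single G (g • t))) (g • t') = coeff (f (single G t)) t' := by
  rw [← single_smul_single, map_smul, coeff_single_smul]

instance : Module.Free ℤ (PermModule G T) :=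
  .of_equiv ((MonoidAlgebra.coeffLinearEquiv (S := ℤ) ℤ (M := T)).symm.trans
    (Representation.ofMulAction ℤ G T).asModuleEquiv.symm)

instance [Finite T] : Module.Finite ℤ (PermModule G T) :=
  .equiv ((MonoidAlgebra.coeffLinearEquiv (S := ℤ) ℤ (M := T)).symm.trans
    (Representation.ofMulAction ℤ G T).asModuleEquiv.symm)

variable {ι : Type} {F : ι → Type v} [∀ a, MulAction G (F a)]

/-- Extension of scalars for permutation modules. -/
def toPi (R : Type*) [CommRing R] : PermModule G (Σ a, F a) →ₗ[ℤ[G]]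
    (Representation.piFamily fun a => Representation.ofMulAction R G (F a)).toInt.asModule :=
  Representation.asModuleHom _ _
    { toFun := fun x a => .ofCoeff ((x.coeff.split a).mapRange Int.cast Int.cast_zero)
      map_zero' := by ext; simp [Finsupp.split_apply]
      map_add' := fun x y => by ext; simp [Finsupp.split_apply] } fun g x => by
    funext a
    ext t
    refine Eq.trans ?_ (Representation.coeff_ofMulAction g (H := F a) _ _).symm
    exact congrArg Int.cast (Representation.coeff_ofMulAction g x (⟨a, t⟩ : Σ a, F a))

theorem toPi_apply (R : Type*) [CommRing R] (x : PermModule G (Σ a, F a)) (a : ι) (t : F a) :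
    ((show ∀ a, R[F a] from toPi R x) a).coeff t = (coeff x ⟨a, t⟩ : R) := rfl

theorem toPi_injective (R : Type*) [CommRing R] [CharZero R] :
    Function.Injective (toPi R : PermModule G (Σ a, F a) →ₗ[ℤ[G]] _) := by
  intro x y h
  refine MonoidAlgebra.ext (Finsupp.ext fun t => ?_)
  have := congrArg (fun z : ∀ a, R[F a] => (z t.1).coeff t.2) h
  exact Int.cast_injective this

/-- The standard `R`-basis consists of images of integral basis vectors, so only the scalars have
denominators. -/
theorem exists_smul_mem_range_toPi {R : Type*} [CommRing R] (S : Submonoid ℕ) [Finite ι]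
    (hR : ∀ r : R, ∃ s ∈ S, ∃ z : ℤ, (s : R) * r = z)
    (x : (Representation.piFamily fun a => Representation.ofMulAction R G (F a)).toInt.asModule) :
    ∃ s ∈ S, s • x ∈ LinearMap.range (toPi R : PermModule G (Σ a, F a) →ₗ[ℤ[G]] _) := by
  classical
  cases nonempty_fintype ι
  let b := Pi.basis fun a =>
    Module.Basis.ofRepr (MonoidAlgebra.coeffLinearEquiv (S := R) R (M := F a))
  refine exists_smul_mem_of_span (V := ∀ a, R[F a]) S hR (Set.range b) b.span_eq
    (LinearMap.range (toPi R : PermModule G (Σ a, F a) →ₗ[ℤ[G]] _)).toAddSubgroup ?_ x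
  rintro _ ⟨⟨a, t⟩, rfl⟩
  refine ⟨single G ⟨a, t⟩, ?_⟩
  refine funext fun a' => MonoidAlgebra.ext (Finsupp.ext fun t' => ?_)
  refine (toPi_apply R _ a' t').trans ?_
  rw [coeff_single, show b ⟨a, t⟩ = _ from Pi.basis_apply _ _]
  by_cases ha : a = a'
  · subst ha
    simp [Finsupp.single_apply]
  · simp [ha]

end PermModule

end

/-! ### From relations to integral maps of permutation modules -/

section

variable {G : Type v} [Group G] [Finite G]

/-- The `ℤ[G]`-span of an `R`-basis works: it is finitely generated over `ℤ` because `G` is finite,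
and free because `L` is torsion-free. -/
theorem exists_lattice {R L : Type*} [CommRing R] [IsDomain R] [CharZero R] [AddCommGroup L]
    [Module R L] [Module.Free R L] [Module.Finite R L] (ρ : Representation R G L) (S : Submonoid ℕ)
    (hR : ∀ r : R, ∃ s ∈ S, ∃ z : ℤ, (s : R) * r = z) :
    ∃ Λ : Submodule ℤ[G] ρ.toInt.asModule, Module.Free ℤ Λ ∧ Module.Finite ℤ Λ ∧
      ∀ x, ∃ s ∈ S, s • x ∈ Λ := by
  let b := Module.Free.chooseBasis R L
  let Λ : Submodule ℤ[G] ρ.toInt.asModule := Submodule.span ℤ[G]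
    (Set.range fun i => (b i : ρ.toInt.asModule))
  have : Module.Finite ℤ[G] Λ := Module.Finite.span_of_finite _ (Set.finite_range _)
  have : Module.Finite ℤ ℤ[G] :=
    .equiv (MonoidAlgebra.coeffLinearEquiv (S := ℤ) ℤ (M := G)).symm
  have : Module.Finite ℤ Λ := Module.Finite.trans ℤ[G] Λ
  have : Module.IsTorsionFree ℤ L := by
    have : Module.IsTorsionFree R L := inferInstance
    exact Module.IsTorsionFree.trans R
  have : Module.IsTorsionFree ℤ ρ.toInt.asModule := this
  have : Module.IsTorsionFree ℤ Λ := inferInstance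
  refine ⟨Λ, inferInstance, inferInstance, fun x => ?_⟩
  exact exists_smul_mem_of_span (V := L) S hR (Set.range b) b.span_eq
    Λ.toAddSubgroup (fun _ hx => Submodule.subset_span (M := ρ.toInt.asModule) hx) x

/-- A stable isomorphism of permutation modules over a localization `R` of `ℤ` yields integral
maps of permutation modules that are mutually inverse up to an integer prime to `p`. -/
theorem PermModule.exists_of_equiv {R : Type} [CommRing R] [IsDomain R] [CharZero R]
    {p : ℕ} [Fact p.Prime] (S : Submonoid ℕ)
    (hR : ∀ r : R, ∃ s ∈ S, ∃ z : ℤ, (s : R) * r = z) (hS : ∀ s ∈ S, s ≠ 0)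
    (hp : (∀ s ∈ S, s.Coprime p) ∨ ¬ p ∣ Nat.card G) {J K : Type} [Finite J] [Finite K]
    {F : J → Type v} {F' : K → Type v} [∀ j, MulAction G (F j)] [∀ k, MulAction G (F' k)]
    [∀ j, Finite (F j)] [∀ k, Finite (F' k)] (L : RepLattice R G)
    (e : (L.carrier × ∀ j, R[F j]) ≃ₗ[R] (L.carrier × ∀ k, R[F' k]))
    (he : ∀ g x, e (L.rep.prod (.piFamily fun j => .ofMulAction R G (F j)) g x) =
        L.rep.prod (.piFamily fun k => .ofMulAction R G (F' k)) g (e x)) :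
    ∃ m : ℕ, m.Coprime p ∧ ∃ (f : PermModule G (Σ j, F j) →ₗ[ℤ[G]] PermModule G (Σ k, F' k))
      (g : PermModule G (Σ k, F' k) →ₗ[ℤ[G]] PermModule G (Σ j, F j)),
      (∀ x, f (g x) = m • x) ∧ ∀ x, g (f x) = m • x := by
  obtain ⟨Λ, _, _, hΛ⟩ := exists_lattice L.rep S hR
  have hinc : ∀ {J : Type} [Finite J] {F : J → Type v} [∀ j, MulAction G (F j)],
      ∃ i : (Λ × PermModule G (Σ j, F j)) →ₗ[ℤ[G]] (L.rep.prod
          (.piFamily fun j => .ofMulAction R G (F j))).toInt.asModule,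
        Function.Injective i ∧ ∀ x : (L.rep.prod
          (.piFamily fun j => .ofMulAction R G (F j))).toInt.asModule,
          ∃ s ∈ S, s • x ∈ LinearMap.range i := by
    intro J _ F _
    let i : (Λ × PermModule G (Σ j, F j)) →ₗ[ℤ[G]] (L.rep.toInt.asModule ×
        (Representation.piFamily fun j => Representation.ofMulAction R G (F j)).toInt.asModule) :=
      Λ.subtype.prodMap (PermModule.toPi R)
    -- The identity on elements, passing from the product of the two modules to the module of the
    -- product representation.
    let c : (L.rep.toInt.asModule ×
        (Representation.piFamily fun j => Representation.ofMulAction R G (F j)).toInt.asModule)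
        →ₗ[ℤ[G]] (L.rep.prod (.piFamily fun j => .ofMulAction R G (F j))).toInt.asModule :=
      MonoidAlgebra.equivariantOfLinearOfComm
        (AddMonoidHom.toIntLinearMap ⟨⟨fun x => x, rfl⟩, fun _ _ => rfl⟩) fun g v => by
          rw [Representation.single_smul, one_smul]
          refine Prod.ext ?_ ?_
          · exact (Representation.single_smul _ 1 g v.1).trans (one_smul ℤ _)
          · exact (Representation.single_smul _ 1 g v.2).trans (one_smul ℤ _)
    refine ⟨c ∘ₗ i, fun x y h => ?_, fun x => ?_⟩
    · have h : i x = i y := h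
      exact Prod.map_injective.mpr ⟨Subtype.val_injective, PermModule.toPi_injective R⟩ h
    · obtain ⟨s, hs, hsx⟩ := hΛ x.1
      obtain ⟨t, ht, y, hy⟩ := PermModule.exists_smul_mem_range_toPi (G := G) (F := F) S hR x.2
      refine ⟨s * t, S.mul_mem hs ht, (t • ⟨_, hsx⟩, s • y), Prod.ext ?_ ?_⟩
      · change t • s • x.1 = (s * t) • x.1
        rw [mul_comm, mul_smul]
      · refine (map_nsmul (PermModule.toPi R) s y).trans ?_
        rw [hy]
        exact (mul_smul s t _).symm
  obtain ⟨i, hi, hi'⟩ := hinc (F := F)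
  obtain ⟨j, hj, hj'⟩ := hinc (F := F')
  let Φ := Representation.asModuleHom (L.rep.prod (.piFamily fun j => .ofMulAction R G (F j))).toInt
    (L.rep.prod (.piFamily fun j => .ofMulAction R G (F' j))).toInt
    e.toLinearMap.toAddMonoidHom he
  let Ψ := Representation.asModuleHom
    (L.rep.prod (.piFamily fun j => .ofMulAction R G (F' j))).toInt
    (L.rep.prod (.piFamily fun j => .ofMulAction R G (F j))).toInt
    e.symm.toLinearMap.toAddMonoidHom fun g x => by
      refine e.symm_apply_eq.mpr ?_
      refine Eq.trans ?_ (he g (e.symm x)).symm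
      exact congrArg _ (e.apply_symm_apply x).symm
  have hΦΨ : ∀ x, Φ (Ψ x) = x := e.apply_symm_apply
  have hΨΦ : ∀ x, Ψ (Φ x) = x := e.symm_apply_apply
  -- The integral maps are restrictions of `s • Φ` and `t • Ψ`, so both composites are `s * t`, an
  -- element of `S`.
  obtain ⟨s, hs, f, hf⟩ := exists_smul_restrict S Φ i j hj hj'
  obtain ⟨t, ht, g, hg⟩ := exists_smul_restrict S Ψ j i hi hi'
  have hst := S.mul_mem hs ht
  refine exists_coprime_inverse_of_prod (hS _ hst) (hp.imp_left fun h => h _ hst) f g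
    (fun x => hj ?_) (fun x => hi ?_)
  · rw [hf, hg, map_nsmul, hΦΨ, map_nsmul, mul_smul]
  · rw [hg, hf, map_nsmul, hΨΦ, map_nsmul, mul_comm, mul_smul]

end

/-! ### Hecke operators on chains of quotients -/

section Hecke

open CategoryTheory Limits Simplicial

/-- A simplicial set with an action of `G` together with its quotients by the subgroups of `G`. -/
structure SimplicialOrbits (G : Type v) [Group G] where
  /-- The total simplicial set. -/
  total : SSet.{w}
  /-- The action. -/
  act : G → (total ⟶ total)
  act_one : act 1 = 𝟙 _
  act_mul : ∀ g h, act (g * h) = act h ≫ act g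
  /-- The quotients. -/
  quot : Subgroup G → SSet.{w}
  /-- The projections. -/
  proj : ∀ U, total ⟶ quot U
  proj_surjective : ∀ U n, Function.Surjective ((proj U).app n)
  proj_eq_iff : ∀ U n s s', (proj U).app n s = (proj U).app n s' ↔ ∃ g ∈ U, (act g).app n s' = s

namespace SimplicialOrbits

variable {G : Type v} [Group G] (E : SimplicialOrbits.{v, w} G) {U V W : Subgroup G}

theorem act_mul_apply (g h : G) {n} (s : E.total.obj n) :
    (E.act (g * h)).app n s = (E.act g).app n ((E.act h).app n s) := by
  rw [E.act_mul]; rfl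

theorem act_one_apply {n} (s : E.total.obj n) : (E.act 1).app n s = s := by
  rw [E.act_one]; rfl

/-- The image of a translated simplex in a quotient. -/
def translate (t : G ⧸ V) {n} (s : E.total.obj n) : (E.quot V).obj n :=
  (E.proj V).app n ((E.act t.out⁻¹).app n s)

/-- Another representative `h * v` of the coset replaces `h⁻¹ s` by `v⁻¹ h⁻¹ s`, which has the same
image modulo `V`. -/
theorem translate_mk (h : G) {n} (s : E.total.obj n) :
    E.translate (h : G ⧸ V) s = (E.proj V).app n ((E.act h⁻¹).app n s) := by
  rw [translate, E.proj_eq_iff]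
  obtain ⟨v, hv⟩ := QuotientGroup.mk_out_eq_mul V h
  refine ⟨(v : G)⁻¹, inv_mem v.2, ?_⟩
  rw [← act_mul_apply, hv, mul_inv_rev]

theorem translate_smul (g : G) (t : G ⧸ V) {n} (s : E.total.obj n) :
    E.translate (g • t) ((E.act g).app n s) = E.translate t s := by
  obtain ⟨h, rfl⟩ := QuotientGroup.mk_surjective t
  rw [MulAction.Quotient.smul_coe, translate_mk, translate_mk, ← act_mul_apply, smul_eq_mul,
    mul_inv_rev, inv_mul_cancel_right]

theorem translate_one {n} (s : E.total.obj n) :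
    E.translate ((1 : G) : G ⧸ V) s = (E.proj V).app n s := by
  rw [translate_mk, inv_one, act_one_apply]

theorem map_translate (t : G ⧸ V) {m n} (f : m ⟶ n) (s : E.total.obj m) :
    (E.quot V).map f (E.translate t s) = E.translate t (E.total.map f s) := by
  simp only [translate, NatTrans.naturality_apply]

/-- A preimage of a simplex under the projection. -/
def lift {n} (x : (E.quot U).obj n) : E.total.obj n := (E.proj_surjective U n x).choose

theorem proj_lift {n} (x : (E.quot U).obj n) : (E.proj U).app n (E.lift x) = x :=
  (E.proj_surjective U n x).choose_spec

variable {C : Type*} [Category C] [HasCoproducts.{w} C] [Preadditive C] {R : C}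

theorem hecke_ext {D : ChainComplex C ℕ} {φ ψ : (E.quot U).chainComplex R ⟶ D}
    (h : ∀ n (s : E.total _⦋n⦌), (E.quot U).ιChainComplex ((E.proj U).app _ s) ≫ φ.f n =
      (E.quot U).ιChainComplex ((E.proj U).app _ s) ≫ ψ.f n) : φ = ψ := by
  ext n : 1
  refine SSet.chainComplex_hom_ext fun x => ?_
  obtain ⟨s, rfl⟩ := E.proj_surjective U _ x
  exact h n s

variable (R) [∀ U : Subgroup G, Fintype (G ⧸ U)]

/-- An integer matrix on a product of `G`-sets that is invariant under `G`. -/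
def _root_.IsInvariantKernel (G : Type*) [Group G] {T T' : Type*} [MulAction G T] [MulAction G T']
    (a : T → T' → ℤ) : Prop :=
  ∀ (g : G) t s, a (g • t) (g • s) = a t s

/-- The chain associated to an invariant kernel and a simplex. -/
def heckeChain (a : G ⧸ U → G ⧸ V → ℤ) {n : ℕ} (s : E.total _⦋n⦌) :
    R ⟶ ((E.quot V).chainComplex R).X n :=
  ∑ t, a (1 : G) t • (E.quot V).ιChainComplex (E.translate t s)

variable {R}

/-- Replacing `s` by `u s` with `u ∈ U` permutes the cosets `t` by `u`. The coefficients `a(1, t)`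
are unchanged since `u` fixes the base coset of `G ⧸ U`. This makes the operator well defined on
simplices of the quotient. -/
theorem heckeChain_eq_of_proj_eq {a : G ⧸ U → G ⧸ V → ℤ} (ha : IsInvariantKernel G a) {n : ℕ}
    {s s' : E.total _⦋n⦌} (h : (E.proj U).app _ s = (E.proj U).app _ s') :
    E.heckeChain R a s = E.heckeChain R a s' := by
  obtain ⟨u, hu, rfl⟩ := (E.proj_eq_iff U _ _ _).mp h
  rw [heckeChain, ← Equiv.sum_comp (MulAction.toPerm u)]
  refine Finset.sum_congr rfl fun t _ => ?_
  rw [MulAction.toPerm_apply, translate_smul]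
  congr 1
  rw [← ha u _ t]
  congr 1
  rw [MulAction.Quotient.smul_coe, QuotientGroup.eq]
  simpa using hu

/-- The map on `n`-chains attached to a matrix. -/
def heckeF (a : G ⧸ U → G ⧸ V → ℤ) (n : ℕ) :
    ((E.quot U).chainComplex R).X n ⟶ ((E.quot V).chainComplex R).X n :=
  Cofan.IsColimit.desc ((E.quot U).isColimitChainComplexXCofan R n) fun x =>
    E.heckeChain R a (E.lift x)

theorem ι_heckeF {a : G ⧸ U → G ⧸ V → ℤ} (ha : IsInvariantKernel G a) {n : ℕ}
    (s : E.total _⦋n⦌) : (E.quot U).ιChainComplex ((E.proj U).app _ s) ≫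
      E.heckeF (R := R) a n = E.heckeChain R a s :=
  (Cofan.IsColimit.fac ((E.quot U).isColimitChainComplexXCofan R n) _ _).trans
    (E.heckeChain_eq_of_proj_eq ha (E.proj_lift _))

/-- The map of chain complexes attached to an invariant kernel. -/
def hecke (a : G ⧸ U → G ⧸ V → ℤ) (ha : IsInvariantKernel G a) :
    (E.quot U).chainComplex R ⟶ (E.quot V).chainComplex R where
  f n := E.heckeF a n
  comm' i j hij := by
    obtain rfl : j + 1 = i := hij
    refine SSet.chainComplex_hom_ext fun x => ?_
    obtain ⟨s, rfl⟩ := E.proj_surjective U _ x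
    rw [← Category.assoc, E.ι_heckeF ha, SSet.ιChainComplex_d_assoc, Preadditive.sum_comp,
      heckeChain, Preadditive.sum_comp]
    simp only [Preadditive.zsmul_comp, SSet.ιChainComplex_d]
    have hδ : ∀ i, (E.quot U).δ i ((E.proj U).app _ s) = (E.proj U).app _ (E.total.δ i s) :=
      fun i => (NatTrans.naturality_apply (E.proj U) _ s).symm
    have hδ' : ∀ i (t : G ⧸ V), (E.quot V).δ i (E.translate t s) = E.translate t (E.total.δ i s) :=
      fun i t => E.map_translate t _ s
    simp only [hδ, E.ι_heckeF ha, hδ', heckeChain, Finset.smul_sum]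
    rw [Finset.sum_comm]
    simp only [smul_comm (a _ _)]

theorem ι_hecke_f (a : G ⧸ U → G ⧸ V → ℤ) (ha : IsInvariantKernel G a) {n : ℕ}
    (s : E.total _⦋n⦌) : (E.quot U).ιChainComplex ((E.proj U).app _ s) ≫
      (E.hecke (R := R) a ha).f n = E.heckeChain R a s :=
  E.ι_heckeF ha s

theorem hecke_comp (a : G ⧸ U → G ⧸ V → ℤ) (ha : IsInvariantKernel G a)
    (b : G ⧸ V → G ⧸ W → ℤ) (hb : IsInvariantKernel G b) (c : G ⧸ U → G ⧸ W → ℤ)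
    (hc : IsInvariantKernel G c) (h : ∀ t t'', c t t'' = ∑ t', a t t' * b t' t'') :
    E.hecke (R := R) a ha ≫ E.hecke b hb = E.hecke c hc := by
  refine E.hecke_ext fun n s => ?_
  rw [HomologicalComplex.comp_f, ← Category.assoc, ι_hecke_f, ι_hecke_f, heckeChain,
    Preadditive.sum_comp, heckeChain]
  -- For a representative `h` of `t`, the substitution `t'' ↦ h⁻¹ t''` turns `b(1, h⁻¹ t'')` into
  -- `b(t, t'')` by invariance and undoes the translation of `s`.
  have : ∀ t : G ⧸ V, (E.quot V).ιChainComplex (E.translate t s) ≫ (E.hecke (R := R) b hb).f n =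
      ∑ t'', b t t'' • (E.quot W).ιChainComplex (E.translate t'' s) := by
    intro t
    rw [translate, ι_hecke_f, heckeChain, ← Equiv.sum_comp (MulAction.toPerm t.out⁻¹)]
    refine Finset.sum_congr rfl fun t' _ => ?_
    rw [MulAction.toPerm_apply, translate_smul, ← hb t.out]
    congr 2
    · rw [MulAction.Quotient.smul_coe, smul_eq_mul, mul_one, QuotientGroup.out_eq']
    · rw [smul_inv_smul]
  simp only [Preadditive.zsmul_comp, this, h, Finset.smul_sum, Finset.sum_smul, mul_smul]
  exact Finset.sum_comm

theorem hecke_sum {ι : Type*} [Fintype ι] (a : ι → G ⧸ U → G ⧸ V → ℤ)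
    (ha : ∀ i, IsInvariantKernel G (a i)) (c : G ⧸ U → G ⧸ V → ℤ)
    (hc : IsInvariantKernel G c) (h : ∀ t t', c t t' = ∑ i, a i t t') :
    E.hecke (R := R) c hc = ∑ i, E.hecke (a i) (ha i) := by
  refine E.hecke_ext fun n s => ?_
  have : (∑ i, E.hecke (R := R) (a i) (ha i)).f n = ∑ i, (E.hecke (R := R) (a i) (ha i)).f n :=
    map_sum (HomologicalComplex.Hom.fAddMonoidHom n) _ _
  rw [ι_hecke_f, heckeChain, this, Preadditive.comp_sum]
  simp only [ι_hecke_f, heckeChain, h, Finset.sum_smul]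
  exact Finset.sum_comm

theorem hecke_eq_zsmul_id (m : ℤ) (c : G ⧸ U → G ⧸ U → ℤ) (hc : IsInvariantKernel G c)
    [DecidableEq (G ⧸ U)] (h : ∀ t t', c t t' = if t = t' then m else 0) :
    E.hecke (R := R) c hc = m • 𝟙 _ := by
  refine E.hecke_ext fun n s => ?_
  rw [ι_hecke_f, heckeChain]
  simp [h, ite_smul, translate_one]

theorem hecke_eq_zero (c : G ⧸ U → G ⧸ V → ℤ) (hc : IsInvariantKernel G c)
    (h : ∀ t t', c t t' = 0) : E.hecke (R := R) c hc = 0 := by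
  refine E.hecke_ext fun n s => ?_
  rw [ι_hecke_f, heckeChain]
  simp [h]

end SimplicialOrbits

end Hecke

/-! ### Singular simplices of covering spaces -/

section Covering

open CategoryTheory Limits Simplicial

theorem toSSetObjEquiv_map {S T : TopCat.{u}} (f : S ⟶ T) {n} (s : (TopCat.toSSet.obj S).obj n)
    (x : stdSimplex ℝ (Fin (n.unop.len + 1))) :
    T.toSSetObjEquiv n ((TopCat.toSSet.map f).app n s) x = f (S.toSSetObjEquiv n s x) := rfl

theorem simplyConnectedSpace_stdSimplex (n : ℕ) :
    SimplyConnectedSpace (stdSimplex ℝ (Fin (n + 1))) :=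
  have : ContractibleSpace (stdSimplex ℝ (Fin (n + 1))) :=
    (convex_stdSimplex ℝ _).contractibleSpace ⟨_, single_mem_stdSimplex ℝ 0⟩
  inferInstance

variable {G : Type v} [Group G] {X : Type u} {Y : Type w} [TopologicalSpace X]
  [TopologicalSpace Y] [MulAction G X] {f : X → Y}

theorem IsQuotientCoveringMap.subgroup (hf : IsQuotientCoveringMap f G) (U : Subgroup G) :
    IsQuotientCoveringMap (Quotient.mk (MulAction.orbitRel U X)) U where
  __ := isQuotientMap_quotient_mk'
  continuous_const_smul g := hf.continuous_const_smul (g : G)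
  apply_eq_iff_mem_orbit := Quotient.eq''
  disjoint e := by
    obtain ⟨W, hW, h⟩ := hf.disjoint e
    exact ⟨W, hW, fun g hg => Subtype.ext (h g hg)⟩

/-- The singular simplicial set of a covering space with its deck transformations. -/
def IsQuotientCoveringMap.simplicialOrbits (hf : IsQuotientCoveringMap f G) :
    SimplicialOrbits.{v, u} G where
  total := TopCat.toSSet.obj (TopCat.of X)
  act g := TopCat.toSSet.map (TopCat.ofHom ⟨fun x => g • x, hf.continuous_const_smul g⟩)
  act_one := by
    rw [← CategoryTheory.Functor.map_id]
    congr 1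
    ext x
    exact one_smul G x
  act_mul g h := by
    rw [← CategoryTheory.Functor.map_comp]
    congr 1
    ext x
    exact mul_smul g h x
  quot U := TopCat.toSSet.obj (TopCat.of (Quotient (MulAction.orbitRel U X)))
  proj U := TopCat.toSSet.map (TopCat.ofHom ⟨_, (hf.subgroup U).continuous⟩)
  -- A simplex is simply connected and locally path connected, so every singular simplex of `X/U`
  -- lifts to `X`.
  proj_surjective U n x := by
    have := simplyConnectedSpace_stdSimplex n.unop.len
    have := (convex_stdSimplex ℝ (Fin (n.unop.len + 1))).locallyPathConnectedSpace
    obtain ⟨a⟩ : Nonempty (stdSimplex ℝ (Fin (n.unop.len + 1))) := inferInstance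
    obtain ⟨e, he⟩ := (hf.subgroup U).surjective (TopCat.toSSetObjEquiv _ n x a)
    obtain ⟨F, ⟨-, hF⟩, -⟩ := (hf.subgroup U).isCoveringMap.existsUnique_continuousMap_lifts
      (TopCat.toSSetObjEquiv _ n x) a e he
    refine ⟨(TopCat.toSSetObjEquiv (TopCat.of X) n).symm F, (TopCat.toSSetObjEquiv _ n).injective
      (ContinuousMap.ext fun y => ?_)⟩
    rw [toSSetObjEquiv_map, Equiv.apply_symm_apply]
    exact congrFun hF y
  proj_eq_iff U n s s' := by
    constructor
    · intro h
      have := simplyConnectedSpace_stdSimplex n.unop.len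
      have := (convex_stdSimplex ℝ (Fin (n.unop.len + 1))).locallyPathConnectedSpace
      obtain ⟨a⟩ : Nonempty (stdSimplex ℝ (Fin (n.unop.len + 1))) := inferInstance
      set σ := TopCat.toSSetObjEquiv (TopCat.of X) n s with hσ
      set σ' := TopCat.toSSetObjEquiv (TopCat.of X) n s' with hσ'
      have h' : ∀ x, Quotient.mk (MulAction.orbitRel U X) (σ x) =
          Quotient.mk (MulAction.orbitRel U X) (σ' x) := fun x =>
        congrArg (fun t => TopCat.toSSetObjEquiv _ n t x) h
      obtain ⟨g, hg⟩ := (hf.subgroup U).apply_eq_iff_mem_orbit.mp (h' a)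
      refine ⟨g, g.2, (TopCat.toSSetObjEquiv (TopCat.of X) n).injective ?_⟩
      have hg' : Continuous fun x : X => (g : G) • x := hf.continuous_const_smul (g : G)
      -- `g σ'` and `σ` lift the same simplex and agree at the vertex-independent base point `a`,
      -- hence everywhere by uniqueness of lifts.
      refine ((hf.subgroup U).isCoveringMap.existsUnique_continuousMap_lifts
        ((⟨_, (hf.subgroup U).continuous⟩ : C(X, _)).comp σ) a (σ a) rfl).unique
        (y₁ := (⟨_, hg'⟩ : C(X, X)).comp σ') (y₂ := σ) ⟨hg, ?_⟩ ⟨rfl, rfl⟩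
      funext x
      exact ((hf.subgroup U).map_smul g).trans (h' x).symm
    · rintro ⟨g, hg, rfl⟩
      refine (TopCat.toSSetObjEquiv _ n).injective (ContinuousMap.ext fun x => ?_)
      exact (hf.subgroup U).map_smul ⟨g, hg⟩

variable (hf : IsQuotientCoveringMap f G) (i : ℕ) [∀ U : Subgroup G, Fintype (G ⧸ U)]
  {U V W : Subgroup G}

namespace IsQuotientCoveringMap

/-- The map on the homology of quotients of a covering space attached to an invariant kernel. -/
def heckeHom (a : G ⧸ U → G ⧸ V → ℤ) (ha : IsInvariantKernel G a) :
    quotientHomology X i U →+ quotientHomology X i V :=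
  (HomologicalComplex.homologyMap (hf.simplicialOrbits.hecke
    (R := ModuleCat.of ℤ (ULift.{u} ℤ)) a ha) i).hom.toAddMonoidHom

/-- This is one block of a product of block matrices, with the `V j` indexing the middle blocks. It
holds because Hecke operators respect sums and products of kernels and homology is an additive
functor. -/
theorem sum_heckeHom_heckeHom {J : Type*} [Fintype J] {V : J → Subgroup G}
    {a : ∀ j, G ⧸ U → G ⧸ V j → ℤ} (ha : ∀ j, IsInvariantKernel G (a j))
    {b : ∀ j, G ⧸ V j → G ⧸ W → ℤ} (hb : ∀ j, IsInvariantKernel G (b j))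
    {c : G ⧸ U → G ⧸ W → ℤ} (hc : IsInvariantKernel G c)
    (h : ∀ t t'', c t t'' = ∑ j, ∑ t', a j t t' * b j t' t'') (x : quotientHomology X i U) :
    ∑ j, hf.heckeHom i (b j) (hb j) (hf.heckeHom i (a j) (ha j) x) = hf.heckeHom i c hc x := by
  have hab : ∀ j, IsInvariantKernel G fun t t'' => ∑ t', a j t t' * b j t' t'' := by
    intro j g t t''
    dsimp only
    rw [← Equiv.sum_comp (MulAction.toPerm g)]
    refine Finset.sum_congr rfl fun t' _ => ?_
    rw [MulAction.toPerm_apply, ha j g, hb j g]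
  have key : HomologicalComplex.homologyMap (hf.simplicialOrbits.hecke
      (R := ModuleCat.of ℤ (ULift.{u} ℤ)) c hc) i =
      ∑ j, HomologicalComplex.homologyMap (hf.simplicialOrbits.hecke
        (R := ModuleCat.of ℤ (ULift.{u} ℤ)) (a j) (ha j)) i ≫ HomologicalComplex.homologyMap
        (hf.simplicialOrbits.hecke (R := ModuleCat.of ℤ (ULift.{u} ℤ)) (b j) (hb j)) i := by
    rw [hf.simplicialOrbits.hecke_sum _ hab c hc h]
    refine ((HomologicalComplex.homologyFunctor (ModuleCat.{u} ℤ) _ i).map_sum _ _).trans ?_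
    refine Finset.sum_congr rfl fun j _ => ?_
    rw [← HomologicalComplex.homologyMap_comp,
      hf.simplicialOrbits.hecke_comp (a j) (ha j) (b j) (hb j) _ (hab j) fun _ _ => rfl]
    rfl
  let ev : (quotientHomology X i U ⟶ quotientHomology X i W) →+ quotientHomology X i W :=
    ⟨⟨fun φ => φ.hom x, rfl⟩, fun _ _ => rfl⟩
  exact ((congrArg ev key).trans (map_sum ev _ _)).symm

theorem heckeHom_eq_zsmul [DecidableEq (G ⧸ U)] {c : G ⧸ U → G ⧸ U → ℤ}
    (hc : IsInvariantKernel G c) (m : ℤ) (h : ∀ t t', c t t' = if t = t' then m else 0)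
    (x : quotientHomology X i U) : hf.heckeHom i c hc x = m • x := by
  have key : HomologicalComplex.homologyMap (hf.simplicialOrbits.hecke
      (R := ModuleCat.of ℤ (ULift.{u} ℤ)) c hc) i = m • 𝟙 _ := by
    rw [hf.simplicialOrbits.hecke_eq_zsmul_id m c hc h]
    refine ((HomologicalComplex.homologyFunctor (ModuleCat.{u} ℤ) _ i).map_zsmul).trans ?_
    rw [CategoryTheory.Functor.map_id]
    rfl
  exact congrArg (fun φ => φ.hom x) key

theorem heckeHom_eq_zero {c : G ⧸ U → G ⧸ V → ℤ} (hc : IsInvariantKernel G c)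
    (h : ∀ t t', c t t' = 0) (x : quotientHomology X i U) : hf.heckeHom i c hc x = 0 := by
  have key : HomologicalComplex.homologyMap (hf.simplicialOrbits.hecke
      (R := ModuleCat.of ℤ (ULift.{u} ℤ)) c hc) i = 0 := by
    rw [hf.simplicialOrbits.hecke_eq_zero c hc h]
    exact (HomologicalComplex.homologyFunctor (ModuleCat.{u} ℤ) _ i).map_zero _ _
  exact congrArg (fun φ => φ.hom x) key

end IsQuotientCoveringMap

end Covering

/-! ### Primary components and orders of torsion subgroups -/

section PrimaryComponent

open AddCommGroup

/-- The restriction of a homomorphism to `p`-primary components. -/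
def primaryComponentMap {A B : Type*} [AddCommGroup A] [AddCommGroup B] (p : ℕ) (h : A →+ B) :
    primaryComponent A p →+ primaryComponent B p :=
  (h.comp (primaryComponent A p).subtype).codRestrict _ fun ⟨x, k, hk⟩ =>
    ⟨k, by
      change p ^ k • h x = 0
      rw [← map_nsmul, hk, map_zero]⟩

@[simp]
theorem coe_primaryComponentMap {A B : Type*} [AddCommGroup A] [AddCommGroup B] (p : ℕ)
    (h : A →+ B) (x : primaryComponent A p) : (primaryComponentMap p h x : B) = h x := rfl

theorem exists_pow_smul_pi_primaryComponent {J : Type*} [Fintype J] {A : J → Type*}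
    [∀ j, AddCommGroup (A j)] {p : ℕ} (x : ∀ j, primaryComponent (A j) p) :
    ∃ n, p ^ n • x = 0 := by
  choose n hn using fun j => (x j).2
  refine ⟨∑ j, n j, funext fun j => Subtype.ext ?_⟩
  obtain ⟨c, hc⟩ := Finset.dvd_prod_of_mem (fun j => p ^ n j) (Finset.mem_univ j)
  have hj : p ^ n j • (x j : A j) = 0 := hn j
  change p ^ (∑ j, n j) • (x j : A j) = 0
  rw [← Finset.prod_pow_eq_pow_sum, hc, mul_comm, mul_smul, hj, smul_zero]

theorem exists_zsmul_nsmul_eq {C : Type*} [AddCommGroup C] {p m : ℕ} (hm : m.Coprime p) {x : C}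
    {n : ℕ} (hx : p ^ n • x = 0) : ∃ u : ℤ, u • m • x = x := by
  obtain ⟨u, v, huv⟩ := Nat.isCoprime_iff_coprime.mpr (hm.pow_right n)
  refine ⟨u, ?_⟩
  calc u • m • x = (u * m + v * (p ^ n : ℕ)) • x := by
        rw [add_smul, mul_smul, mul_smul, natCast_zsmul, natCast_zsmul, hx, smul_zero, add_zero]
    _ = x := by rw [huv, one_smul]

/-- Homomorphisms of `p`-primary groups that are mutually inverse up to an integer prime to `p`
are isomorphisms. -/
theorem nonempty_addEquiv_of_coprime {A B : Type*} [AddCommGroup A] [AddCommGroup B] {p m : ℕ}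
    (hm : m.Coprime p) (hA : ∀ x : A, ∃ n, p ^ n • x = 0) (hB : ∀ x : B, ∃ n, p ^ n • x = 0)
    (f : A →+ B) (g : B →+ A) (hfg : ∀ x, f (g x) = m • x) (hgf : ∀ x, g (f x) = m • x) :
    Nonempty (A ≃+ B) := by
  refine ⟨.ofBijective f ⟨(injective_iff_map_eq_zero f).mpr fun x hx => ?_, fun y => ?_⟩⟩
  · obtain ⟨n, hn⟩ := hA x
    obtain ⟨v, hv⟩ := exists_zsmul_nsmul_eq hm hn
    rw [← hv, ← hgf, hx, map_zero, smul_zero]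
  · obtain ⟨n, hn⟩ := hB y
    obtain ⟨v, hv⟩ := exists_zsmul_nsmul_eq hm hn
    exact ⟨v • g y, by rw [map_zsmul, hfg, hv]⟩

theorem primaryComponent_le_torsion (A : Type*) [AddCommGroup A] (p : ℕ) [Fact p.Prime] :
    primaryComponent A p ≤ torsion A := fun _ ⟨k, hk⟩ =>
  isOfFinAddOrder_iff_nsmul_eq_zero.mpr ⟨p ^ k, pow_pos (Fact.out : p.Prime).pos k, hk⟩

theorem card_primaryComponent_ne_zero {A : Type*} [AddCommGroup A] {p : ℕ} [Fact p.Prime]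
    (h : Nat.card (torsion A) ≠ 0) : Nat.card (primaryComponent A p) ≠ 0 := by
  have : Finite (torsion A) := (Nat.card_ne_zero.mp h).2
  have : Finite (primaryComponent A p) := Finite.of_injective _
    (AddSubgroup.inclusion_injective (primaryComponent_le_torsion A p))
  exact Nat.card_ne_zero.mpr ⟨inferInstance, inferInstance⟩

/-- A finite torsion subgroup and the `p`-primary component have the same `p`-adic order. -/
theorem padicValNat_card_torsion {A : Type*} [AddCommGroup A] (p : ℕ) [Fact p.Prime]
    (h : Nat.card (torsion A) ≠ 0) :
    padicValNat p (Nat.card (torsion A)) = padicValNat p (Nat.card (primaryComponent A p)) := by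
  have hle := primaryComponent_le_torsion A p
  have : Finite (torsion A) := (Nat.card_ne_zero.mp h).2
  let P := (primaryComponent A p).addSubgroupOf (torsion A)
  have hP : Nat.card P = Nat.card (primaryComponent A p) :=
    Nat.card_congr (AddSubgroup.addSubgroupOfEquivOfLe hle).toEquiv
  have hindex : ¬ p ∣ P.index := by
    intro hdvd
    cases nonempty_fintype (torsion A ⧸ P)
    -- Cauchy gives a class of order `p` in the quotient. But if `p x` is `p`-primary then so is
    -- `x`, and the class is zero.
    obtain ⟨x, hx⟩ := exists_prime_addOrderOf_dvd_card (G := torsion A ⧸ P) p (by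
      rwa [← Nat.card_eq_fintype_card])
    obtain ⟨x, rfl⟩ := QuotientAddGroup.mk_surjective x
    have h0 : ((p • x : torsion A) : torsion A ⧸ P) = 0 := by
      have := addOrderOf_nsmul_eq_zero (x : torsion A ⧸ P)
      rwa [hx] at this
    obtain ⟨k, hk⟩ := (QuotientAddGroup.eq_zero_iff _).mp h0
    have : x ∈ P := ⟨k + 1, by rw [pow_succ, mul_smul]; exact hk⟩
    rw [(QuotientAddGroup.eq_zero_iff x).mpr this, addOrderOf_zero] at hx
    exact (Fact.out : p.Prime).ne_one hx.symm
  rw [← P.card_mul_index, padicValNat.mul Nat.card_pos.ne' AddSubgroup.index_ne_zero_of_finite,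
    padicValNat.eq_zero_of_not_dvd hindex, add_zero, hP]

theorem padicValRat_prod_pow {J : Type*} [Fintype J] (p : ℕ) [Fact p.Prime] (c n : J → ℕ)
    (hc : ∀ j, c j ≠ 0) :
    padicValRat p (∏ j, (c j : ℚ) ^ n j) = ∑ j, n j * padicValNat p (c j) := by
  classical
  have : ∀ s : Finset J, padicValRat p (∏ j ∈ s, (c j : ℚ) ^ n j) =
      ∑ j ∈ s, (n j : ℤ) * padicValNat p (c j) := by
    intro s
    induction s using Finset.induction_on with
    | empty => simp
    | insert a s ha ih =>
      have h : ∀ j, (c j : ℚ) ^ n j ≠ 0 := fun j => pow_ne_zero _ (Nat.cast_ne_zero.mpr (hc j))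
      rw [Finset.prod_insert ha, Finset.sum_insert ha,
        padicValRat.mul (h a) (Finset.prod_ne_zero_iff.mpr fun j _ => h j), ih,
        padicValRat.pow, padicValRat.of_nat]
  simpa only [Nat.cast_sum, Nat.cast_mul] using this Finset.univ

theorem padicValRat_torsion_quotient {J K : Type} [Fintype J] [Fintype K] (p : ℕ)
    [Fact p.Prime] {A : J → Type*} [∀ j, AddCommGroup (A j)] {B : K → Type*}
    [∀ k, AddCommGroup (B k)] {n : J → ℕ} {n' : K → ℕ} (hn : ∀ j, 0 < n j) (hn' : ∀ k, 0 < n' k)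
    (h : Nonempty ((⨁ j, (Fin (n j) → primaryComponent (A j) p)) ≃+
      (⨁ k, (Fin (n' k) → primaryComponent (B k) p)))) :
    padicValRat p ((∏ j, (Nat.card (torsion (A j)) : ℚ) ^ n j) /
      ∏ k, (Nat.card (torsion (B k)) : ℚ) ^ n' k) = 0 := by
  obtain ⟨e⟩ := h
  -- An infinite torsion subgroup has `Nat.card` equal to `0`. Its exponent is positive, so the
  -- whole product is `0`, and the quotient and its valuation vanish by convention.
  by_cases hA : ∀ j, Nat.card (torsion (A j)) ≠ 0
  swap
  · push Not at hA
    obtain ⟨j, hj⟩ := hA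
    rw [Finset.prod_eq_zero (Finset.mem_univ j) (by simp [hj, (hn j).ne']), zero_div,
      padicValRat.zero]
  by_cases hB : ∀ k, Nat.card (torsion (B k)) ≠ 0
  swap
  · push Not at hB
    obtain ⟨k, hk⟩ := hB
    rw [Finset.prod_eq_zero (s := Finset.univ (α := K)) (Finset.mem_univ k)
      (by simp [hk, (hn' k).ne']), div_zero, padicValRat.zero]
  have hcard := Nat.card_congr (((DirectSum.addEquivProd _).symm.trans
    (e.trans (DirectSum.addEquivProd _))).toEquiv)
  simp only [Nat.card_pi, Finset.prod_const, Finset.card_univ,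
    Fintype.card_fin] at hcard
  rw [padicValRat.div
      (Finset.prod_ne_zero_iff.mpr fun j _ => pow_ne_zero _ (Nat.cast_ne_zero.mpr (hA j)))
      (Finset.prod_ne_zero_iff.mpr fun j _ => pow_ne_zero _ (Nat.cast_ne_zero.mpr (hB j))),
    padicValRat_prod_pow p _ _ hA, padicValRat_prod_pow p _ _ hB, sub_eq_zero]
  simp only [padicValNat_card_torsion p (hA _), padicValNat_card_torsion p (hB _)]
  have := congrArg (fun c : ℕ => padicValRat p (c : ℚ)) hcard
  simp only [Nat.cast_prod, Nat.cast_pow] at this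
  rwa [padicValRat_prod_pow p _ _ fun j => card_primaryComponent_ne_zero (hA j),
    padicValRat_prod_pow p _ _ fun k => card_primaryComponent_ne_zero (hB k)] at this

end PrimaryComponent

/-! ### Maps on primary homology and the main theorem -/

section Main

variable {G : Type v} [Group G] {X : Type u} {Y : Type w} [TopologicalSpace X]
  [TopologicalSpace Y] [MulAction G X] {f : X → Y}

open AddCommGroup

theorem PermModule.isInvariantKernel {J K : Type} {F : J → Type v} {F' : K → Type v}
    [∀ j, MulAction G (F j)] [∀ k, MulAction G (F' k)]
    (φ : PermModule G (Σ j, F j) →ₗ[ℤ[G]] PermModule G (Σ k, F' k)) (j : J) (k : K) :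
    IsInvariantKernel G fun (t : F j) (s : F' k) => coeff (φ (single G ⟨j, t⟩)) ⟨k, s⟩ :=
  fun g t s => coeff_map_smul φ g ⟨j, t⟩ ⟨k, s⟩

/-- A map of permutation modules induces a map on the `p`-primary homology of the quotients. -/
def IsQuotientCoveringMap.permHom (hf : IsQuotientCoveringMap f G) (p i : ℕ)
    [∀ U : Subgroup G, Fintype (G ⧸ U)] {J K : Type} [Fintype J]
    {U : J → Subgroup G} {U' : K → Subgroup G}
    (φ : PermModule G (Σ j, G ⧸ U j) →ₗ[ℤ[G]] PermModule G (Σ k, G ⧸ U' k)) :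
    (∀ j, primaryComponent (quotientHomology X i (U j)) p) →+
      ∀ k, primaryComponent (quotientHomology X i (U' k)) p :=
  AddMonoidHom.mk' (fun x k => ∑ j,
    primaryComponentMap p (hf.heckeHom i _ (PermModule.isInvariantKernel φ j k)) (x j))
    fun x y => by
      funext k
      simp only [Pi.add_apply, map_add, Finset.sum_add_distrib]

theorem IsQuotientCoveringMap.permHom_permHom (hf : IsQuotientCoveringMap f G) (p i : ℕ)
    [∀ U : Subgroup G, Fintype (G ⧸ U)] {J K : Type} [Fintype J] [Fintype K]
    {U : J → Subgroup G} {U' : K → Subgroup G}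
    (φ : PermModule G (Σ j, G ⧸ U j) →ₗ[ℤ[G]] PermModule G (Σ k, G ⧸ U' k))
    (ψ : PermModule G (Σ k, G ⧸ U' k) →ₗ[ℤ[G]] PermModule G (Σ j, G ⧸ U j)) {m : ℕ}
    (h : ∀ x, ψ (φ x) = m • x) (x : ∀ j, primaryComponent (quotientHomology X i (U j)) p) :
    hf.permHom p i ψ (hf.permHom p i φ x) = m • x := by
  classical
  funext j'
  refine Subtype.ext ?_
  -- The blocks of the matrix of `ψ ∘ φ = m`: `m` times the identity for `j = j'`, and zero
  -- otherwise.
  have hc : ∀ j, IsInvariantKernel G fun (t : G ⧸ U j) (t' : G ⧸ U j') =>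
      PermModule.coeff (m • PermModule.single G (⟨j, t⟩ : Σ j, G ⧸ U j)) ⟨j', t'⟩ := fun j => by
    have := PermModule.isInvariantKernel (ψ ∘ₗ φ) j j'
    simpa only [LinearMap.comp_apply, h] using this
  have key : ∀ j (y : quotientHomology X i (U j)),
      ∑ k, hf.heckeHom i _ (PermModule.isInvariantKernel ψ k j')
        (hf.heckeHom i _ (PermModule.isInvariantKernel φ j k) y) = hf.heckeHom i _ (hc j) y := by
    intro j y
    refine hf.sum_heckeHom_heckeHom i (PermModule.isInvariantKernel φ j)
      (fun k => PermModule.isInvariantKernel ψ k j') (hc j) (fun t t'' => ?_) y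
    rw [← h, PermModule.coeff_map, Fintype.sum_sigma]
  have hdiag : ∀ y, hf.heckeHom i _ (hc j') y = (m : ℤ) • y := hf.heckeHom_eq_zsmul i _ m
    fun t t' => by
      rw [PermModule.coeff_nsmul, PermModule.coeff_single]
      simp
  have hoff : ∀ j ≠ j', ∀ y, hf.heckeHom i _ (hc j) y = 0 := fun j hj =>
    hf.heckeHom_eq_zero i _ fun t t' => by
      rw [PermModule.coeff_nsmul, PermModule.coeff_single]
      simp [hj]
  have expand : ((hf.permHom p i ψ (hf.permHom p i φ x) j' :
      primaryComponent (quotientHomology X i (U j')) p) : quotientHomology X i (U j')) =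
      ∑ k, hf.heckeHom i _ (PermModule.isInvariantKernel ψ k j')
        (∑ j, hf.heckeHom i _ (PermModule.isInvariantKernel φ j k) (x j)) := by
    simp [permHom]
  rw [expand]
  simp only [map_sum]
  rw [Finset.sum_comm]
  simp only [key]
  rw [Finset.sum_eq_single j' (fun j _ hj => hoff j hj _) (by simp), hdiag, natCast_zsmul]
  rfl

variable [Finite G]

/-- Relations over a localization of `ℤ` yield isomorphisms of `p`-primary homology groups. -/
theorem IsRelation.nonempty_addEquiv (hf : IsQuotientCoveringMap f G) {R : Type} [CommRing R]
    [IsDomain R] [CharZero R] {p : ℕ} [Fact p.Prime] (i : ℕ) (S : Submonoid ℕ)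
    (hR : ∀ r : R, ∃ s ∈ S, ∃ z : ℤ, (s : R) * r = z) (hS : ∀ s ∈ S, s ≠ 0)
    (hp : (∀ s ∈ S, s.Coprime p) ∨ ¬ p ∣ Nat.card G) {J K : Type} [Fintype J] [Fintype K]
    {U : J → Subgroup G} {U' : K → Subgroup G}
    (h : IsRelation R (∑ j, burnsideOf (U j) - ∑ k, burnsideOf (U' k))) :
    Nonempty ((∀ j, primaryComponent (quotientHomology X i (U j)) p) ≃+
      ∀ k, primaryComponent (quotientHomology X i (U' k)) p) := by
  have := fun U : Subgroup G => Fintype.ofFinite (G ⧸ U)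
  obtain ⟨L, e, he⟩ := h.exists_equiv
  obtain ⟨m, hm, φ, ψ, hφψ, hψφ⟩ := PermModule.exists_of_equiv S hR hS hp L e he
  exact nonempty_addEquiv_of_coprime hm exists_pow_smul_pi_primaryComponent
    exists_pow_smul_pi_primaryComponent (hf.permHom p i φ) (hf.permHom p i ψ)
    (hf.permHom_permHom p i ψ φ hφψ) (hf.permHom_permHom p i φ ψ hψφ)

theorem IsRelation.nonempty_directSum_addEquiv (hf : IsQuotientCoveringMap f G) {R : Type}
    [CommRing R] [IsDomain R] [CharZero R] {p : ℕ} [Fact p.Prime] (i : ℕ) (S : Submonoid ℕ)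
    (hR : ∀ r : R, ∃ s ∈ S, ∃ z : ℤ, (s : R) * r = z) (hS : ∀ s ∈ S, s ≠ 0)
    (hp : (∀ s ∈ S, s.Coprime p) ∨ ¬ p ∣ Nat.card G) {J K : Type} [Fintype J] [Fintype K]
    {U : J → Subgroup G} {n : J → ℕ} {U' : K → Subgroup G} {n' : K → ℕ}
    (h : IsRelation R (∑ j, n j • burnsideOf (U j) - ∑ k, n' k • burnsideOf (U' k))) :
    Nonempty ((⨁ j, (Fin (n j) → primaryComponent (quotientHomology X i (U j)) p)) ≃+
      (⨁ k, (Fin (n' k) → primaryComponent (quotientHomology X i (U' k)) p))) := by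
  -- Multiplicities are absorbed into the index type, each subgroup `U j` being repeated `n j`
  -- times.
  have hsum : ∀ {J : Type} [Fintype J] (U : J → Subgroup G) (n : J → ℕ),
      ∑ j, n j • burnsideOf (U j) = ∑ a : Σ j, Fin (n j), burnsideOf (U a.1) := by
    intro J _ U n
    rw [Fintype.sum_sigma]
    simp
  rw [hsum, hsum] at h
  obtain ⟨e⟩ := h.nonempty_addEquiv hf i S hR hS hp
  have hcurry : ∀ {J : Type} [Fintype J] (n : J → ℕ) (A : J → Type u) [∀ j, AddCommGroup (A j)],
      Nonempty ((⨁ j, (Fin (n j) → A j)) ≃+ ∀ a : Σ j, Fin (n j), A a.1) := fun n A _ =>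
    ⟨(DirectSum.addEquivProd _).trans
      { (Equiv.piCurry fun j (_ : Fin (n j)) => A j).symm with map_add' := fun _ _ => rfl }⟩
  obtain ⟨e₁⟩ := hcurry n fun j => primaryComponent (quotientHomology X i (U j)) p
  obtain ⟨e₂⟩ := hcurry n' fun k => primaryComponent (quotientHomology X i (U' k)) p
  exact ⟨e₁.trans (e.trans e₂.symm)⟩

/-- The natural numbers prime to `p`. -/
def coprimeSubmonoid (p : ℕ) : Submonoid ℕ where
  carrier := {s | s.Coprime p}
  one_mem' := Nat.coprime_one_left p
  mul_mem' := Nat.Coprime.mul_left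

theorem zLocal_exists_mul_eq {p : ℕ} [Fact p.Prime] (r : zLocal p) :
    ∃ s ∈ coprimeSubmonoid p, ∃ z : ℤ, (s : zLocal p) * r = z :=
  ⟨r.1.den, ((Fact.out : p.Prime).coprime_iff_not_dvd.mpr r.2).symm, r.1.num,
    Subtype.ext (by push_cast; exact Rat.den_mul_eq_num r.1)⟩

theorem rat_exists_mul_eq (r : ℚ) : ∃ s ∈ nonZeroDivisors ℕ, ∃ z : ℤ, (s : ℚ) * r = z :=
  ⟨r.den, mem_nonZeroDivisors_of_ne_zero r.den_ne_zero, r.num, Rat.den_mul_eq_num r⟩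

end Main

end

theorem mainTheorem1 {G : Type v} [Group G] [Finite G]
    {X : Type u} {Y : Type w} [TopologicalSpace X] [TopologicalSpace Y] [MulAction G X]
    (f : X → Y) (hf : IsQuotientCoveringMap f G)
    (p : ℕ) [Fact p.Prime] (i : ℕ) :
    (∀ (J K : Type) [Fintype J] [Fintype K]
        (U : J → Subgroup G) (n : J → ℕ) (U' : K → Subgroup G) (n' : K → ℕ),
        (∀ j, 0 < n j) → (∀ k, 0 < n' k) →
        IsRelation (zLocal p)
          (∑ j, n j • burnsideOf (U j) - ∑ k, n' k • burnsideOf (U' k)) →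
        Nonempty
          ((⨁ j, (Fin (n j) → AddCommGroup.primaryComponent (quotientHomology X i (U j)) p)) ≃+
            (⨁ k, (Fin (n' k) → AddCommGroup.primaryComponent (quotientHomology X i (U' k)) p))) ∧
        padicValRat p
          ((∏ j, (Nat.card (AddCommGroup.torsion (quotientHomology X i (U j))) : ℚ) ^ n j) /
            ∏ k, (Nat.card (AddCommGroup.torsion (quotientHomology X i (U' k))) : ℚ) ^ n' k) = 0) ∧
    (¬ p ∣ Nat.card G →
      (∀ (J K : Type) [Fintype J] [Fintype K]
        (U : J → Subgroup G) (n : J → ℕ) (U' : K → Subgroup G) (n' : K → ℕ),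
        (∀ j, 0 < n j) → (∀ k, 0 < n' k) →
        IsRelation ℚ
          (∑ j, n j • burnsideOf (U j) - ∑ k, n' k • burnsideOf (U' k)) →
        Nonempty
          ((⨁ j, (Fin (n j) → AddCommGroup.primaryComponent (quotientHomology X i (U j)) p)) ≃+
            (⨁ k, (Fin (n' k) → AddCommGroup.primaryComponent (quotientHomology X i (U' k)) p)))) ∧
      ∀ U₁ U₂ : Subgroup G, IsRelation ℚ (burnsideOf U₁ - burnsideOf U₂) →
        Nonempty (AddCommGroup.primaryComponent (quotientHomology X i U₁) p ≃+
          AddCommGroup.primaryComponent (quotientHomology X i U₂) p)) := by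
  have hQ : ∀ s ∈ nonZeroDivisors ℕ, s ≠ 0 := fun s hs => nonZeroDivisors.ne_zero hs
  refine ⟨fun J K _ _ U n U' n' hn hn' h => ?_, fun hp => ⟨fun J K _ _ U n U' n' hn hn' h =>
    h.nonempty_directSum_addEquiv hf i _ rat_exists_mul_eq hQ (.inr hp), fun U₁ U₂ h => ?_⟩⟩
  -- Over `ℤ_(p)` the denominators are prime to `p`, so no condition on `#G` is needed; over `ℚ`
  -- they are arbitrary and `p ∤ #G` takes over.
  · have e := h.nonempty_directSum_addEquiv hf (p := p) i _ zLocal_exists_mul_eq (fun s hs h0 => by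
      subst h0
      exact (Fact.out : p.Prime).ne_one (Nat.coprime_zero_left p |>.mp hs)) (.inl fun s hs => hs)
    exact ⟨e, padicValRat_torsion_quotient p hn hn' e⟩
  · have h' : IsRelation ℚ (∑ _ : Unit, burnsideOf U₁ - ∑ _ : Unit, burnsideOf U₂) := by
      simpa using h
    obtain ⟨e⟩ := h'.nonempty_addEquiv hf i _ rat_exists_mul_eq hQ (.inr hp)
    exact ⟨(AddEquiv.piUnique _).symm.trans (e.trans (AddEquiv.piUnique _))⟩
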